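/- Conventions. Let $S$ be a semigroup and $S^1$ the monoid obtained by adjoining a formal unit. Green's relations are $a\,\mathcal R\,b\iff aS^1=bS^1$, $a\,\mathcal L\,b\iff S^1a=S^1b$, $a\,\mathcal J\,b\iff S^1aS^1=S^1bS^1$, $\mathcal H=\mathcal R\cap\mathcal L$. A $\mathcal J$-class is regular if it contains an element $a$ with $aba=a$ for some $b\in S$; such a class contains an idempotent. For an idempotent $e$, the $\mathcal H$-class $G_e$ of $e$ is a group with unit $e$, and $\mathcal L(e)$ denotes the $\mathcal L$-class of $e$. Let $E\subseteq S$ be a commutative subsemigroup consisting of idempotents (projections). Write $a\,\tilde{\mathcal L}\,b$ if for all $e\in E$: $ae=a\iff be=b$, and $a\,\tilde{\mathcal R}\,b$ if for all $e\in E$: $ea=a\iff eb=b$. The semigroup $S$ is $E$-Ehresmann if every $\tilde{\mathcal L}$-class and every $\tilde{\mathcal R}$-class contains a unique element of $E$ (denoted $a^*$, respectively $a^+$, for the class of $a$), $\tilde{\mathcal L}$ is a right congruence and $\tilde{\mathcal R}$ is a left congruence. It is right restriction if moreover $ea=a(ea)^*$ for all $a\in S$, $e\in E$. The Ehresmann category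 of $S$ has object set $E$, its morphisms $e\to f$ are the elements $a\in S$ with $a^*=e$ and $a^+=f$, and composition is the product of $S$ (from right to left). $S$ is EI-Ehresmann if every endomorphism in this category is an isomorphism. Let $\Bbbk$ be a field. If $S$ is a finite Ehresmann semigroup, the semigroup algebra $\Bbbk S$ has an identity element, and modules over it are unital left modules. For an idempotent $e$, the space $\Bbbk\mathcal L(e)$ with basis $\mathcal L(e)$ is a $(\Bbbk S,\Bbbk G_e)$-bimodule: $s\in S$ sends $x\in\mathcal L(e)$ to $sx$ if $sx\in\mathcal L(e)$ and to $0$ otherwise, and $G_e$ acts by right multiplication. Theorem. Let $S$ be a finite right restriction EI-Ehresmann semigroup and let $\Bbbk$ be a field. For every regular $\mathcal J$-class $J$ choose an idempotent $e_J\in J$, put $G_J=G_{e_J}$, and for a $\Bbbk G_J$-module $V$ let $$\operatorname{Ind}_{G_J}(V)=\Bbbk\mathcal L(e_J)\otimes_{\Bbbk G_J}V .$$ Then, for any such choice: 1. for every regular $\mathcal J$-class $J$ and every simple $\Bbbk G_J$-module $V$, the $\Bbbk S$-module $\operatorname{Ind}_{G_J}(V)$ is simple; 2. every simple $\Bbbk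 S$-module is isomorphic to $\operatorname{Ind}_{G_J}(V)$ for some regular $\mathcal J$-class $J$ and some simple $\Bbbk G_J$-module $V$; 3. if $V$ is a simple $\Bbbk G_J$-module, $V'$ is a simple $\Bbbk G_{J'}$-module and $\operatorname{Ind}_{G_J}(V)\cong\operatorname{Ind}_{G_{J'}}(V')$ as $\Bbbk S$-modules, then $J=J'$; and for simple $\Bbbk G_J$-modules $V,V'$ one has $\operatorname{Ind}_{G_J}(V)\cong\operatorname{Ind}_{G_J}(V')$ as $\Bbbk S$-modules if and only if $V\cong V'$ as $\Bbbk G_J$-modules. -/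

import Mathlib

open scoped TensorProduct

universe u v w

noncomputable section

/-! ### Green's relations on a semigroup `S`, through the monoid `S¹ = WithOne S` -/

section Green

variable {S : Type u} [Semigroup S]

/-- `a L b` iff `S¹a = S¹b`. -/
def GreenL (a b : S) : Prop :=
  {x : WithOne S | ∃ s : WithOne S, x = s * (a : WithOne S)} =
    {x : WithOne S | ∃ s : WithOne S, x = s * (b : WithOne S)}

/-- `a R b` iff `aS¹ = bS¹`. -/
def GreenR (a b : S) : Prop :=
  {x : WithOne S | ∃ s : WithOne S, x = (a : WithOne S) * s} =
    {x : WithOne S | ∃ s : WithOne S, x = (b : WithOne S) * s}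

/-- `a J b` iff `S¹aS¹ = S¹bS¹`. -/
def GreenJ (a b : S) : Prop :=
  {x : WithOne S | ∃ s t : WithOne S, x = s * (a : WithOne S) * t} =
    {x : WithOne S | ∃ s t : WithOne S, x = s * (b : WithOne S) * t}

/-- `H = R ∩ L`. -/
def GreenH (a b : S) : Prop := GreenR a b ∧ GreenL a b

theorem greenL_iff {a b : S} : GreenL a b ↔
    (∃ s : WithOne S, (a : WithOne S) = s * b) ∧ (∃ s : WithOne S, (b : WithOne S) = s * a) := by
  constructor
  · intro h
    have h1 : (a : WithOne S) ∈ {x : WithOne S | ∃ s : WithOne S, x = s * (a : WithOne S)} :=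
      ⟨1, by simp⟩
    have h2 : (b : WithOne S) ∈ {x : WithOne S | ∃ s : WithOne S, x = s * (b : WithOne S)} :=
      ⟨1, by simp⟩
    exact ⟨by rwa [h] at h1, by rwa [← h] at h2⟩
  · rintro ⟨⟨s, hs⟩, t, ht⟩
    ext x
    constructor
    · rintro ⟨r, rfl⟩
      exact ⟨r * s, by rw [hs, mul_assoc]⟩
    · rintro ⟨r, rfl⟩
      exact ⟨r * t, by rw [ht, mul_assoc]⟩

theorem greenR_iff {a b : S} : GreenR a b ↔
    (∃ s : WithOne S, (a : WithOne S) = b * s) ∧ (∃ s : WithOne S, (b : WithOne S) = a * s) := by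
  constructor
  · intro h
    have h1 : (a : WithOne S) ∈ {x : WithOne S | ∃ s : WithOne S, x = (a : WithOne S) * s} :=
      ⟨1, by simp⟩
    have h2 : (b : WithOne S) ∈ {x : WithOne S | ∃ s : WithOne S, x = (b : WithOne S) * s} :=
      ⟨1, by simp⟩
    exact ⟨by rwa [h] at h1, by rwa [← h] at h2⟩
  · rintro ⟨⟨s, hs⟩, t, ht⟩
    ext x
    constructor
    · rintro ⟨r, rfl⟩
      exact ⟨s * r, by rw [hs, mul_assoc]⟩
    · rintro ⟨r, rfl⟩
      exact ⟨t * r, by rw [ht, mul_assoc]⟩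

theorem GreenL.refl (a : S) : GreenL a a := Eq.refl _
theorem GreenL.symm {a b : S} (h : GreenL a b) : GreenL b a := Eq.symm h
theorem GreenL.trans {a b c : S} (h : GreenL a b) (h' : GreenL b c) : GreenL a c := Eq.trans h h'

theorem GreenL.mul_right {a b : S} (h : GreenL a b) (c : S) : GreenL (a * c) (b * c) := by
  obtain ⟨⟨s, hs⟩, t, ht⟩ := greenL_iff.1 h
  exact greenL_iff.2 ⟨⟨s, by rw [WithOne.coe_mul, hs, WithOne.coe_mul, mul_assoc]⟩,
    ⟨t, by rw [WithOne.coe_mul, ht, WithOne.coe_mul, mul_assoc]⟩⟩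

/-- If `stx L x` then already `tx L x`. -/
theorem GreenL.of_mul_mul {s t x : S} (h : GreenL (s * (t * x)) x) : GreenL (t * x) x := by
  obtain ⟨-, r, hr⟩ := greenL_iff.1 h
  refine greenL_iff.2 ⟨⟨(t : WithOne S), by rw [WithOne.coe_mul]⟩, ⟨r * s, ?_⟩⟩
  rw [hr, WithOne.coe_mul, ← mul_assoc]

variable (S) in
/-- The equivalence relation `J`. -/
def greenJSetoid : Setoid S where
  r := GreenJ
  iseqv := ⟨fun _ => Eq.refl _, fun h => Eq.symm h, fun h h' => Eq.trans h h'⟩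

variable (S) in
/-- The regular `J`-classes of `S`: those that contain a regular element. -/
abbrev RegularJClass : Type u :=
  {J : Quotient (greenJSetoid S) // ∃ a b : S, Quotient.mk (greenJSetoid S) a = J ∧ a * b * a = a}

variable (S) in
/-- The set `E(S)` of all idempotents of `S`. -/
abbrev Idempotents : Type u := {e : S // IsIdempotentElem e}

/-- The idempotent `e` belongs to the `J`-class `J`. -/
def Idempotents.MemJClass (e : Idempotents S) (J : RegularJClass S) : Prop :=
  Quotient.mk (greenJSetoid S) e.1 = J.1

/-- A regular `J`-class contains an idempotent. -/
theorem RegularJClass.exists_idempotent (J : RegularJClass S) :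
    ∃ e : Idempotents S, e.MemJClass J := by
  obtain ⟨J, a, b, rfl, hab⟩ := J
  have hab' : (a : WithOne S) * b * a = a := by exact_mod_cast congrArg (fun x : S => (x : WithOne S)) hab
  refine ⟨⟨a * b, ?_⟩, Quotient.sound ?_⟩
  · change a * b * (a * b) = a * b
    rw [← mul_assoc, hab]
  · change GreenJ (a * b) a
    ext x
    constructor
    · rintro ⟨s, t, rfl⟩
      exact ⟨s, b * t, by simp only [WithOne.coe_mul, mul_assoc]⟩
    · rintro ⟨s, t, rfl⟩
      refine ⟨s, a * t, ?_⟩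
      conv_lhs => rw [← hab']
      simp only [WithOne.coe_mul, mul_assoc]

/-! ### The maximal subgroup at an idempotent -/

/-- The `H`-class of the idempotent `e`. -/
abbrev MaxSubgroup (e : Idempotents S) : Type u := {g : S // GreenH g e.1}

theorem greenH_idem_iff (e : Idempotents S) {g : S} : GreenH g e.1 ↔
    e.1 * g = g ∧ g * e.1 = g ∧ ∃ h : S, e.1 * h = h ∧ h * e.1 = h ∧ g * h = e.1 ∧ h * g = e.1 := by
  obtain ⟨e, he⟩ := e
  have he' : (e : WithOne S) * e = e := by exact_mod_cast congrArg (fun x : S => (x : WithOne S)) he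
  constructor
  · rintro ⟨hR, hL⟩
    obtain ⟨⟨r, hr⟩, y, hy⟩ := greenR_iff.1 hR
    obtain ⟨⟨l, hl⟩, z, hz⟩ := greenL_iff.1 hL
    simp only at hr hy hl hz
    have h1 : (e : WithOne S) * g = g := by rw [hr, ← mul_assoc, he']
    have h2 : (g : WithOne S) * e = g := by rw [hl, mul_assoc, he']
    have hzy : z * e = e * y := by
      conv_lhs => rw [hy]
      rw [← mul_assoc, ← hz]
    obtain ⟨h, hh⟩ : ∃ h : S, (h : WithOne S) = e * y := by
      refine WithOne.cases_on y ⟨e, by simp⟩ fun y => ⟨e * y, by simp⟩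
    refine ⟨by exact_mod_cast h1, by exact_mod_cast h2, h, ?_, ?_, ?_, ?_⟩ <;>
      apply WithOne.coe_injective <;> rw [WithOne.coe_mul, hh]
    · rw [← mul_assoc, he']
    · rw [← hzy, mul_assoc, he']
    · rw [← mul_assoc, h2, ← hy]
    · rw [← hzy, mul_assoc, h1, ← hz]
  · rintro ⟨h1, h2, h, -, -, h3, h4⟩
    simp only at h1 h2 h3 h4
    refine ⟨greenR_iff.2 ⟨⟨g, ?_⟩, ⟨h, ?_⟩⟩, greenL_iff.2 ⟨⟨g, ?_⟩, ⟨h, ?_⟩⟩⟩ <;>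
      rw [← WithOne.coe_mul] <;> simp only [h1, h2, h3, h4]

/-- The group structure on the `H`-class of an idempotent, with the product of `S`. -/
instance MaxSubgroup.instGroup (e : Idempotents S) : Group (MaxSubgroup e) :=
  let _ : Mul (MaxSubgroup e) := ⟨fun g h => ⟨g.1 * h.1, by
    obtain ⟨g1, g2, g', g3, g4, g5, g6⟩ := (greenH_idem_iff e).1 g.2
    obtain ⟨h1, h2, h', h3, h4, h5, h6⟩ := (greenH_idem_iff e).1 h.2
    refine (greenH_idem_iff e).2 ⟨by rw [← mul_assoc, g1], by rw [mul_assoc, h2],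
      h' * g', by rw [← mul_assoc, h3], by rw [mul_assoc, g4], ?_, ?_⟩
    · rw [mul_assoc, ← mul_assoc h.1, h5, g3, g5]
    · rw [mul_assoc, ← mul_assoc g', g6, h1, h6]⟩⟩
  let _ : One (MaxSubgroup e) := ⟨⟨e.1, Eq.refl _, Eq.refl _⟩⟩
  let _ : Inv (MaxSubgroup e) := ⟨fun g => ⟨((greenH_idem_iff e).1 g.2).2.2.choose, by
    obtain ⟨g1, g2, -⟩ := (greenH_idem_iff e).1 g.2
    obtain ⟨h1, h2, h3, h4⟩ := ((greenH_idem_iff e).1 g.2).2.2.choose_spec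
    exact (greenH_idem_iff e).2 ⟨h1, h2, g.1, g1, g2, h4, h3⟩⟩⟩
  Group.ofLeftAxioms (fun a b c => Subtype.ext (mul_assoc a.1 b.1 c.1))
    (fun a => Subtype.ext ((greenH_idem_iff e).1 a.2).1)
    (fun a => Subtype.ext ((greenH_idem_iff e).1 a.2).2.2.choose_spec.2.2.2)

theorem MaxSubgroup.coe_mul {e : Idempotents S} (g h : MaxSubgroup e) :
    (g * h).1 = g.1 * h.1 := Eq.refl _

theorem MaxSubgroup.coe_one {e : Idempotents S} : (1 : MaxSubgroup e).1 = e.1 := Eq.refl _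

end Green

/-! ### Ehresmann semigroups -/

/-- `a L̃ b` with respect to a set `E` of idempotents. -/
def LTilde {S : Type u} [Semigroup S] (E : Set S) (a b : S) : Prop :=
  ∀ e ∈ E, b * e = b ↔ a * e = a

/-- `a R̃ b` with respect to a set `E` of idempotents. -/
def RTilde {S : Type u} [Semigroup S] (E : Set S) (a b : S) : Prop :=
  ∀ e ∈ E, e * b = b ↔ e * a = a

/-- An `E`-Ehresmann semigroup: `E = proj` is a commutative subsemigroup of idempotents, every
`L̃`-class and every `R̃`-class contains a unique element of `E`, `L̃` is a right congruence and
`R̃` is a left congruence. -/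
class Ehresmann (S : Type u) [Semigroup S] where
  proj : Set S
  proj_idem : ∀ e ∈ proj, e * e = e
  proj_mul : ∀ e ∈ proj, ∀ f ∈ proj, e * f ∈ proj
  proj_comm : ∀ e ∈ proj, ∀ f ∈ proj, e * f = f * e
  existsUnique_star : ∀ a : S, ∃! e : S, e ∈ proj ∧ LTilde proj a e
  existsUnique_plus : ∀ a : S, ∃! e : S, e ∈ proj ∧ RTilde proj a e
  lTilde_mul_right : ∀ a b c : S, LTilde proj a b → LTilde proj (a * c) (b * c)
  rTilde_mul_left : ∀ a b c : S, RTilde proj a b → RTilde proj (c * a) (c * b)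

namespace Ehresmann

variable {S : Type u} [Semigroup S] [Ehresmann S]

/-- `a*`, the unique projection in the `L̃`-class of `a`. -/
def star (a : S) : S := (existsUnique_star a).choose

/-- `a⁺`, the unique projection in the `R̃`-class of `a`. -/
def plus (a : S) : S := (existsUnique_plus a).choose

theorem star_mem (a : S) : star a ∈ proj (S := S) := (existsUnique_star a).choose_spec.1.1
theorem plus_mem (a : S) : plus a ∈ proj (S := S) := (existsUnique_plus a).choose_spec.1.1
theorem lTilde_star (a : S) : LTilde (proj (S := S)) a (star a) :=
  (existsUnique_star a).choose_spec.1.2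
theorem rTilde_plus (a : S) : RTilde (proj (S := S)) a (plus a) :=
  (existsUnique_plus a).choose_spec.1.2

theorem eq_star {a e : S} (he : e ∈ proj (S := S)) (h : LTilde proj a e) : e = star a :=
  (existsUnique_star a).unique ⟨he, h⟩ ⟨star_mem a, lTilde_star a⟩
theorem eq_plus {a e : S} (he : e ∈ proj (S := S)) (h : RTilde proj a e) : e = plus a :=
  (existsUnique_plus a).unique ⟨he, h⟩ ⟨plus_mem a, rTilde_plus a⟩

theorem mul_star (a : S) : a * star a = a :=
  (lTilde_star a _ (star_mem a)).1 (proj_idem _ (star_mem a))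
theorem plus_mul (a : S) : plus a * a = a :=
  (rTilde_plus a _ (plus_mem a)).1 (proj_idem _ (plus_mem a))

theorem star_of_mem {e : S} (he : e ∈ proj (S := S)) : star e = e :=
  (eq_star he fun _ _ => Iff.rfl).symm
theorem plus_of_mem {e : S} (he : e ∈ proj (S := S)) : plus e = e :=
  (eq_plus he fun _ _ => Iff.rfl).symm

theorem star_mul (a b : S) : star (a * b) = star (star a * b) :=
  (eq_star (star_mem _) fun f hf => (lTilde_star (a * b) f hf).trans
    (lTilde_mul_right _ _ b (lTilde_star a) f hf).symm)
theorem plus_mul' (a b : S) : plus (a * b) = plus (a * plus b) :=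
  (eq_plus (plus_mem _) fun f hf => (rTilde_plus (a * b) f hf).trans
    (rTilde_mul_left _ _ a (rTilde_plus b) f hf).symm)

variable (S) in
/-- The objects of the Ehresmann category `C(S)`: the projections of `S`. -/
structure Obj : Type u where
  val : S
  mem : val ∈ proj (S := S)

/-- The morphisms `e ⟶ f` of `C(S)`: the elements `a` of `S` with domain `a* = e` and
range `a⁺ = f`. -/
@[ext] structure Hom (e f : Obj S) : Type u where
  val : S
  star_eq : star val = e.val
  plus_eq : plus val = f.val

/-- The Ehresmann category `C(S)`. Composition is the product of `S`, from right to left: first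
`a` then `b` is `ba`. -/
instance : CategoryTheory.Category.{u} (Obj S) where
  Hom e f := Hom e f
  id e := ⟨e.val, star_of_mem e.mem, plus_of_mem e.mem⟩
  comp a b := ⟨b.val * a.val,
    by rw [star_mul, b.star_eq, ← a.plus_eq, plus_mul, a.star_eq],
    by rw [plus_mul', a.plus_eq, ← b.star_eq, mul_star, b.plus_eq]⟩
  id_comp {e f} a := Hom.ext ((congrArg (a.val * ·) a.star_eq.symm).trans (mul_star a.val))
  comp_id {e f} a := Hom.ext ((congrArg (· * a.val) a.plus_eq.symm).trans (plus_mul a.val))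
  assoc a b c := Hom.ext (mul_assoc c.val b.val a.val).symm

variable (S) in
/-- `S` is right restriction: the right ample identity `ea = a(ea)*` holds. -/
def IsRightRestriction : Prop :=
  ∀ a : S, ∀ e ∈ proj (S := S), e * a = a * star (e * a)

variable (S) in
/-- `S` is EI-Ehresmann: every endomorphism of the category `C(S)` is an isomorphism. -/
def IsEI : Prop :=
  ∀ (e : Obj S) (a : e ⟶ e), CategoryTheory.IsIso a

end Ehresmann

/-! ### The semigroup algebra of a finite Ehresmann semigroup -/

/-- The semigroup algebra `kS`. -/
def SemigroupAlgebra (k : Type v) (S : Type u) [Field k] : Type (max u v) := MonoidAlgebra k S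

namespace SemigroupAlgebra

variable (k : Type v) [Field k] {S : Type u} [Semigroup S]

instance : NonUnitalRing (SemigroupAlgebra k S) :=
  inferInstanceAs (NonUnitalRing (MonoidAlgebra k S))

instance : Module k (SemigroupAlgebra k S) := inferInstanceAs (Module k (MonoidAlgebra k S))

/-- The basis element of `kS` given by `s`. -/
def of (s : S) : SemigroupAlgebra k S := MonoidAlgebra.single s 1

theorem of_mul (s t : S) : of k (s * t) = of k s * of k t := by
  have := MonoidAlgebra.single_mul_single s t (1 : k) 1
  rw [mul_one] at this
  exact this.symm

theorem induction {S : Type u} [Semigroup S] {p : SemigroupAlgebra k S → Prop}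
    (x : SemigroupAlgebra k S) (zero : p 0) (add : ∀ x y, p x → p y → p (x + y))
    (smul_of : ∀ (c : k) (s : S), p (c • of k s)) : p x := by
  refine MonoidAlgebra.induction_linear (motive := p) x zero add fun s c => ?_
  have hsc : c • of k s = (MonoidAlgebra.single s c : MonoidAlgebra k S) :=
    (MonoidAlgebra.smul_single' c s 1).trans (by rw [mul_one])
  exact hsc ▸ smul_of c s

/-- Although `S` need not be a monoid, the algebra `kS` of a finite Ehresmann semigroup has an
identity element (which is necessarily unique). -/
theorem exists_one [Ehresmann S] [Finite S] :
    ∃ u : SemigroupAlgebra k S, ∀ x, u * x = x ∧ x * u = x := by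
  classical
  have key : ∀ F : Finset S, (F : Set S) ⊆ Ehresmann.proj (S := S) →
      ∃ u : SemigroupAlgebra k S, (∀ e ∈ F, of k e * u = of k e) ∧
        ∀ e ∈ Ehresmann.proj (S := S), of k e * u = u * of k e := by
    intro F
    induction F using Finset.induction_on with
    | empty => exact fun _ => ⟨0, by simp, by simp⟩
    | insert e F _ ih =>
      intro hF
      obtain ⟨u, h1, h2⟩ := ih fun x hx => hF (by simp [Finset.mem_coe.1 hx])
      have he : e ∈ Ehresmann.proj (S := S) := hF (by simp)
      have hee : of k e * of k e = of k e := by rw [← of_mul, Ehresmann.proj_idem e he]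
      refine ⟨u + of k e - of k e * u, ?_, ?_⟩
      · intro f hf
        have hfp : f ∈ Ehresmann.proj (S := S) := hF hf
        have hfe : of k f * of k e = of k e * of k f := by
          rw [← of_mul, ← of_mul, Ehresmann.proj_comm f hfp e he]
        rcases Finset.mem_insert.1 hf with rfl | hf
        · rw [mul_sub, mul_add, ← mul_assoc, hee]; abel
        · rw [mul_sub, mul_add, ← mul_assoc, hfe, mul_assoc, h1 f hf]; abel
      · intro f hfp
        have hfe : of k f * of k e = of k e * of k f := by
          rw [← of_mul, ← of_mul, Ehresmann.proj_comm f hfp e he]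
        rw [mul_sub, mul_add, ← mul_assoc, hfe, sub_mul, add_mul, mul_assoc, h2 f hfp, mul_assoc]
  have hfin := (Set.toFinite (Ehresmann.proj (S := S)))
  obtain ⟨u, h1, h2⟩ := key hfin.toFinset (by simp)
  have h1' : ∀ e ∈ Ehresmann.proj (S := S), of k e * u = of k e := fun e he => h1 e (by simpa)
  have hu : ∀ s : S, u * of k s = of k s ∧ of k s * u = of k s := by
    intro s
    constructor
    · have hs := Ehresmann.plus_mul s
      have hp := Ehresmann.plus_mem s
      rw [← hs, of_mul, ← mul_assoc, ← h2 _ hp, h1' _ hp]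
    · have hs := Ehresmann.mul_star s
      rw [← hs, of_mul, mul_assoc, h1' _ (Ehresmann.star_mem s)]
  refine ⟨u, fun x => ?_⟩
  refine induction k (p := fun x => u * x = x ∧ x * u = x) x ⟨mul_zero u, zero_mul u⟩ ?_ ?_
  · rintro x y ⟨h1, h2⟩ ⟨h3, h4⟩
    exact ⟨by rw [mul_add, h1, h3], by rw [add_mul, h2, h4]⟩
  · exact fun c s => ⟨(mul_smul_comm (β := MonoidAlgebra k S) c u _).trans (congrArg (c • ·) (hu s).1),
      (smul_mul_assoc (β := MonoidAlgebra k S) c _ u).trans (congrArg (c • ·) (hu s).2)⟩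

/-- `kS` as a unital ring, for a finite Ehresmann semigroup `S`. -/
instance [Ehresmann S] [Finite S] : Ring (SemigroupAlgebra k S) :=
  { (inferInstance : NonUnitalRing (SemigroupAlgebra k S)) with
    one := (exists_one k).choose
    one_mul := fun x => ((exists_one k).choose_spec x).1
    mul_one := fun x => ((exists_one k).choose_spec x).2 }

end SemigroupAlgebra

/-! ### The left Schützenberger bimodule `kL(e)` -/

section Schutzenberger

variable (k : Type v) [Field k] {S : Type u} [Semigroup S]

/-- The `L`-class of `e`. -/
abbrev LClass (e : Idempotents S) : Type u := {x : S // GreenL x e.1}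

/-- `kL(e)`: formal linear combinations of elements of the `L`-class of `e`. -/
def SchutzenbergerModule (e : Idempotents S) : Type (max u v) := LClass e →₀ k

namespace SchutzenbergerModule

variable (e : Idempotents S)

instance : AddCommGroup (SchutzenbergerModule k e) := inferInstanceAs (AddCommGroup (LClass e →₀ k))
instance : Module k (SchutzenbergerModule k e) := inferInstanceAs (Module k (LClass e →₀ k))

/-- The basis element of `kL(e)` given by `x`. -/
def of {e : Idempotents S} (x : LClass e) : SchutzenbergerModule k e := Finsupp.single x 1

theorem hom_ext {M : Type*} [AddCommGroup M] [Module k M] {f g : SchutzenbergerModule k e →ₗ[k] M}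
    (h : ∀ x : LClass e, f (of k x) = g (of k x)) : f = g :=
  Finsupp.lhom_ext' fun x => LinearMap.ext_ring (h x)

open Classical in
/-- Left multiplication by `s`: `x ↦ sx` if `sx ∈ L(e)`, and `x ↦ 0` otherwise. -/
def leftMul (s : S) : SchutzenbergerModule k e →ₗ[k] SchutzenbergerModule k e :=
  Finsupp.linearCombination k fun x : LClass e =>
    if h : GreenL (s * x.1) e.1 then of k (⟨s * x.1, h⟩ : LClass e) else 0

theorem leftMul_of_pos {s : S} {x : LClass e} (h : GreenL (s * x.1) e.1) :
    leftMul k e s (of k x) = of k (⟨s * x.1, h⟩ : LClass e) := by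
  classical
  have := Finsupp.linearCombination_single k (v := fun x : LClass e =>
    if h : GreenL (s * x.1) e.1 then of k (⟨s * x.1, h⟩ : LClass e) else 0) 1 x
  rw [one_smul, dif_pos h] at this
  exact this

theorem leftMul_of_neg {s : S} {x : LClass e} (h : ¬ GreenL (s * x.1) e.1) :
    leftMul k e s (of k x) = 0 := by
  classical
  have := Finsupp.linearCombination_single k (v := fun x : LClass e =>
    if h : GreenL (s * x.1) e.1 then of k (⟨s * x.1, h⟩ : LClass e) else 0) 1 x
  rw [one_smul, dif_neg h] at this
  exact this

theorem leftMul_mul (s t : S) : leftMul k e (s * t) = leftMul k e s * leftMul k e t := by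
  refine hom_ext k e fun x => ?_
  rw [Module.End.mul_apply]
  by_cases ht : GreenL (t * x.1) e.1
  · rw [leftMul_of_pos k e ht]
    by_cases hs : GreenL (s * (t * x.1)) e.1
    · rw [leftMul_of_pos k e (x := (⟨t * x.1, ht⟩ : LClass e)) hs,
        leftMul_of_pos k e (by rwa [mul_assoc])]
      exact congrArg _ (Subtype.ext (mul_assoc _ _ _))
    · rw [leftMul_of_neg k e (x := (⟨t * x.1, ht⟩ : LClass e)) hs,
        leftMul_of_neg k e (by rwa [mul_assoc])]
  · rw [leftMul_of_neg k e ht, map_zero, leftMul_of_neg]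
    intro h
    rw [mul_assoc] at h
    exact ht ((GreenL.of_mul_mul (h.trans x.2.symm)).trans x.2)

/-- The action of `kS` on `kL(e)`: the linear extension of `leftMul`. -/
def leftAction : SemigroupAlgebra k S →ₙₐ[k] Module.End k (SchutzenbergerModule k e) :=
  (MonoidAlgebra.liftMagma k ⟨leftMul k e, leftMul_mul k e⟩ :
    MonoidAlgebra k S →ₙₐ[k] Module.End k (SchutzenbergerModule k e))

theorem leftAction_of (s : S) : leftAction k e (SemigroupAlgebra.of k s) = leftMul k e s := by
  change (MonoidAlgebra.liftMagma k ⟨leftMul k e, leftMul_mul k e⟩ :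
    MonoidAlgebra k S →ₙₐ[k] Module.End k (SchutzenbergerModule k e)) (MonoidAlgebra.single s 1) = _
  simp

/-- `kL(e)` as a left `kS`-module. -/
instance [Ehresmann S] [Finite S] :
    Module (SemigroupAlgebra k S) (SchutzenbergerModule k e) where
  smul a m := leftAction k e a m
  one_smul m := by
    change leftAction k e (1 : SemigroupAlgebra k S) m = m
    have : leftAction k e (1 : SemigroupAlgebra k S) = LinearMap.id := by
      refine hom_ext k e fun x => ?_
      have hx : leftMul k e (Ehresmann.plus x.1) (of k x) = of k x := by
        have hp := Ehresmann.plus_mul x.1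
        rw [leftMul_of_pos k e (by rw [hp]; exact x.2)]
        exact congrArg _ (Subtype.ext hp)
      have h1 := congrArg (leftAction k e)
        (one_mul (SemigroupAlgebra.of k (Ehresmann.plus x.1)))
      have h2 := (map_mul (leftAction k e) (1 : SemigroupAlgebra k S)
        (SemigroupAlgebra.of k (Ehresmann.plus x.1))).symm.trans h1
      rw [leftAction_of] at h2
      have h3 := LinearMap.congr_fun h2 (of k x)
      rw [Module.End.mul_apply, hx] at h3
      exact h3
    rw [this, LinearMap.id_apply]
  mul_smul a b m := LinearMap.congr_fun (map_mul (leftAction k e) a b) m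
  smul_zero a := map_zero (leftAction k e a)
  smul_add a := map_add (leftAction k e a)
  add_smul a b m := LinearMap.congr_fun (map_add (leftAction k e) a b) m
  zero_smul m := LinearMap.congr_fun (map_zero (leftAction k e)) m

theorem smul_def [Ehresmann S] [Finite S] (a : SemigroupAlgebra k S)
    (m : SchutzenbergerModule k e) : a • m = leftAction k e a m := Eq.refl _

/-- The right translation `x ↦ xg` of `L(e)` by `g ∈ G_e`. -/
def translate (g : MaxSubgroup e) (x : LClass e) : LClass e :=
  ⟨x.1 * g.1, ((x.2.mul_right g.1).trans (by
    rw [((greenH_idem_iff e).1 g.2).1]; exact g.2.2))⟩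

/-- The linear extension of `translate` to `kL(e)`. -/
def rightTranslate (g : MaxSubgroup e) : Module.End k (SchutzenbergerModule k e) :=
  Finsupp.lmapDomain k k (translate e g)

theorem rightTranslate_of (g : MaxSubgroup e) (x : LClass e) :
    rightTranslate k e g (of k x) = of k (translate e g x) :=
  Finsupp.mapDomain_single

theorem mul_idem {e : Idempotents S} (x : LClass e) : x.1 * e.1 = x.1 := by
  obtain ⟨⟨s, hs⟩, -⟩ := greenL_iff.1 x.2
  apply WithOne.coe_injective
  rw [WithOne.coe_mul, hs, mul_assoc, ← WithOne.coe_mul, e.2.eq]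

/-- Right multiplication by `G_e` on `kL(e)`. -/
def rightMul : MaxSubgroup e →* (Module.End k (SchutzenbergerModule k e))ᵐᵒᵖ where
  toFun g := MulOpposite.op (rightTranslate k e g)
  map_one' := by
    apply MulOpposite.unop_injective
    refine hom_ext k e fun x => ?_
    exact (rightTranslate_of k e 1 x).trans (congrArg _ (Subtype.ext (mul_idem x)))
  map_mul' g h := by
    apply MulOpposite.unop_injective
    refine hom_ext k e fun x => ?_
    change rightTranslate k e (g * h) (of k x) =
      rightTranslate k e h (rightTranslate k e g (of k x))
    rw [rightTranslate_of, rightTranslate_of, rightTranslate_of]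
    exact congrArg _ (Subtype.ext (mul_assoc x.1 g.1 h.1).symm)

/-- The right action of `kG_e` on `kL(e)`: the linear extension of `rightMul`. -/
def rightAction :
    MonoidAlgebra k (MaxSubgroup e) →ₐ[k] (Module.End k (SchutzenbergerModule k e))ᵐᵒᵖ :=
  MonoidAlgebra.lift k _ _ (rightMul k e)

/-- `kL(e)` as a right `kG_e`-module, that is, a left module over the opposite algebra. -/
instance : Module (MonoidAlgebra k (MaxSubgroup e))ᵐᵒᵖ (SchutzenbergerModule k e) where
  smul a m := (rightAction k e a.unop).unop m
  one_smul m := by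
    change (rightAction k e 1).unop m = m
    rw [map_one]
    exact Eq.refl _
  mul_smul a b m := by
    change (rightAction k e (b.unop * a.unop)).unop m = _
    rw [map_mul]
    exact Eq.refl _
  smul_zero a := map_zero (rightAction k e a.unop).unop
  smul_add a := map_add (rightAction k e a.unop).unop
  add_smul a b m := by
    change (rightAction k e (a.unop + b.unop)).unop m = _
    rw [map_add]
    exact Eq.refl _
  zero_smul m := by
    change (rightAction k e 0).unop m = _
    rw [map_zero]
    exact Eq.refl _

theorem op_smul_def (r : MonoidAlgebra k (MaxSubgroup e)) (m : SchutzenbergerModule k e) :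
    MulOpposite.op r • m = (rightAction k e r).unop m := Eq.refl _

theorem leftMul_commute (s : S) (g : MaxSubgroup e) :
    Commute (leftMul k e s) (rightTranslate k e g) := by
  refine hom_ext k e fun x => ?_
  rw [Module.End.mul_apply, Module.End.mul_apply, rightTranslate_of]
  by_cases h : GreenL (s * x.1) e.1
  · have h' : GreenL (s * (translate e g x).1) e.1 := by
      have := (translate e g ⟨s * x.1, h⟩).2
      rwa [show (translate e g ⟨s * x.1, h⟩).1 = s * (translate e g x).1 from
        mul_assoc _ _ _] at this
    rw [leftMul_of_pos k e h, leftMul_of_pos k e h', rightTranslate_of]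
    exact congrArg _ (Subtype.ext (mul_assoc _ _ _).symm)
  · have h' : ¬ GreenL (s * (translate e g x).1) e.1 := by
      intro h'
      apply h
      have h2 := (translate e g⁻¹ ⟨_, h'⟩).2
      have h3 : (translate e g⁻¹ ⟨_, h'⟩).1 = s * x.1 := by
        change s * (x.1 * g.1) * (g⁻¹).1 = s * x.1
        rw [mul_assoc, mul_assoc, ← MaxSubgroup.coe_mul, mul_inv_cancel, MaxSubgroup.coe_one,
          mul_idem]
      rwa [h3] at h2
    rw [leftMul_of_neg k e h, leftMul_of_neg k e h', map_zero]

/-- The two actions make `kL(e)` a `(kS, kG_e)`-bimodule. -/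
instance [Ehresmann S] [Finite S] : SMulCommClass (SemigroupAlgebra k S)
    (MonoidAlgebra k (MaxSubgroup e))ᵐᵒᵖ (SchutzenbergerModule k e) where
  smul_comm a r m := by
    suffices h : Commute (leftAction k e a) (rightAction k e r.unop).unop from
      LinearMap.congr_fun h.eq m
    have h1 : ∀ (s : S) (r : MonoidAlgebra k (MaxSubgroup e)),
        Commute (leftMul k e s) (rightAction k e r).unop := by
      intro s r
      induction r using MonoidAlgebra.induction_linear with
      | zero => rw [map_zero]; exact Commute.zero_right _
      | add x y hx hy => rw [map_add]; exact hx.add_right hy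
      | single g c =>
        have hg : rightAction k e (MonoidAlgebra.single g c) =
            c • MulOpposite.op (rightTranslate k e g) := by
          rw [rightAction, MonoidAlgebra.lift_single]
          exact Eq.refl _
        rw [hg]
        exact (leftMul_commute k e s g).smul_right c
    induction a using SemigroupAlgebra.induction with
    | zero => rw [map_zero]; exact Commute.zero_left _
    | add x y hx hy => rw [map_add]; exact hx.add_left hy
    | smul_of c s => rw [map_smul, leftAction_of]; exact (h1 s r.unop).smul_left c

end SchutzenbergerModule

end Schutzenberger

/-! ### Induced modules -/

/-- The tensor product `M ⊗_R N` of an `(A, R)`-bimodule `M` and a left module `N` over a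
(not necessarily commutative) ring `R`, as a left `A`-module: the quotient of `M ⊗_ℤ N` by the
elements `mr ⊗ n - m ⊗ rn`. -/
abbrev BimoduleTensor (A R M N : Type*) [Ring A] [Ring R] [AddCommGroup M] [AddCommGroup N]
    [Module A M] [Module Rᵐᵒᵖ M] [SMulCommClass A Rᵐᵒᵖ M] [Module R N] : Type _ :=
  (M ⊗[ℤ] N) ⧸ Submodule.span A
    {t : M ⊗[ℤ] N | ∃ (m : M) (r : R) (n : N), t = (MulOpposite.op r • m) ⊗ₜ[ℤ] n - m ⊗ₜ[ℤ] (r • n)}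

/-- The induced module `kL(e) ⊗_{kG_e} V`, a left `kS`-module. -/
abbrev InducedModule (k : Type v) [Field k] {S : Type u} [Semigroup S] [Ehresmann S] [Finite S]
    (e : Idempotents S) (V : Type w) [AddCommGroup V] [Module (MonoidAlgebra k (MaxSubgroup e)) V] :
    Type (max u v w) :=
  BimoduleTensor (SemigroupAlgebra k S) (MonoidAlgebra k (MaxSubgroup e))
    (SchutzenbergerModule k e) V

end

/-! A simple `kS`-module `M` has an apex: an idempotent `e` with `eM ≠ 0` that lies in `SsS` for
every `s` not annihilating `M`. The EI condition provides one (`Ehresmann.exists_isApex`). The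
`J`-class of an apex is determined by `M`, and every idempotent of that class is again an apex. At
an apex, finiteness (stability) makes `e(kS)e` act on `eM` through `kG_e`, so `eM` is simple over
`kG_e` and the action of `kS` gives a nonzero map `Ind(eM) → M`. Conversely, for `V ≠ 0`, `e` is an
apex of `Ind(V)`, and `v ↦ e ⊗ v` identifies `V` with `e Ind(V)`. This separates the `J`-classes and
recovers `V`.

What remains is that `Ind(V)` is simple when `V` is, which amounts to the vanishing of its radical,
the set of `t` with `eSt = 0` (`InducedModule.eq_zero_of_coord`). Right ampleness and EI together
give `ee⁺ = e⁺` for every idempotent `e`. Two facts about `L(e)` follow: a projection sends `x ∈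
L(e)` either out of `L(e)` or to `x` itself, and two elements with the same range differ by an
element of `G_e`. Hence every `t` is a sum of terms `x_f ⊗ v_f` with distinct ranges `x_f⁺ = f`, and
the projections act on such sums triangularly. If `f` is minimal with a nonzero term, then `ft = x_f
⊗ v_f`, and any `s` with `s x_f = e` gives `sft = e ⊗ v_f ≠ 0`. So a nonzero `t` generates some `e ⊗
v` with `v ≠ 0`, hence `e ⊗ V`, hence everything. Given simplicity, Schur's lemma makes `Ind(eM) →
M` an isomorphism. -/

noncomputable section

/-! ### Stability of finite semigroups. -/

section FiniteSemigroup

variable {S : Type u} [Semigroup S]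

/-- Multiplication by `b` is injective on `{z | ez = z}`, since multiplication by `a` undoes it. By
finiteness it is surjective, so `bz = e` for some such `z`, and then `a = ae = abz = z`. -/
theorem mul_eq_idempotent_symm [Finite S] {e a b : S} (he : e * e = e) (ha : a * e = a)
    (hb : e * b = b) (hab : a * b = e) : b * a = e := by
  let φ : {z : S // e * z = z} → {z : S // e * z = z} := fun z =>
    ⟨b * z.1, by rw [← mul_assoc, hb]⟩
  have hφ : Function.Injective φ := fun z w h => by
    have := congrArg (fun z => a * z.1) h
    simp only [φ, ← mul_assoc, hab, z.2, w.2] at this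
    exact Subtype.ext this
  obtain ⟨⟨z, hz⟩, hbz⟩ := Finite.surjective_of_injective hφ ⟨e, he⟩
  have hbz' : b * z = e := congrArg Subtype.val hbz
  rw [← hbz', ← ha, ← hbz', ← mul_assoc a, hab, hz]

theorem greenL_idempotent_iff (e : Idempotents S) {x : S} :
    GreenL x e.1 ↔ x * e.1 = x ∧ ∃ t, t * x = e.1 := by
  constructor
  · intro h
    refine ⟨SchutzenbergerModule.mul_idem ⟨x, h⟩, ?_⟩
    obtain ⟨-, t, ht⟩ := greenL_iff.1 h
    cases t with
    | one => exact ⟨e.1, by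
        have : e.1 = x := WithOne.coe_injective (by simpa using ht)
        rw [← this, e.2.eq]⟩
    | coe t => exact ⟨t, WithOne.coe_injective (by simpa using ht.symm)⟩
  · rintro ⟨h, t, ht⟩
    exact greenL_iff.2 ⟨⟨x, by rw [← WithOne.coe_mul, h]⟩, t, by rw [← WithOne.coe_mul, ht]⟩

theorem GreenJ.exists_eq_mul_mul {e : Idempotents S} {a : S} (h : GreenJ e.1 a) :
    ∃ x y, e.1 = x * a * y := by
  have h1 : (e.1 : WithOne S) ∈
      {x : WithOne S | ∃ s t : WithOne S, x = s * (a : WithOne S) * t} := by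
    rw [← h]
    exact ⟨1, 1, by simp⟩
  obtain ⟨s, t, hst⟩ := h1
  -- Since `e = e(sat)e`, the outer factors may be taken to be `es` and `te`, which lie in `S` even
  -- when `s` or `t` is the formal unit.
  have h2 : ∀ s : WithOne S, ∃ x : S, (x : WithOne S) = e.1 * s := fun s => by
    cases s with
    | one => exact ⟨e.1, by simp⟩
    | coe s => exact ⟨e.1 * s, by simp⟩
  have h3 : ∀ s : WithOne S, ∃ x : S, (x : WithOne S) = s * e.1 := fun s => by
    cases s with
    | one => exact ⟨e.1, by simp⟩
    | coe s => exact ⟨s * e.1, by simp⟩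
  obtain ⟨x, hx⟩ := h2 s
  obtain ⟨y, hy⟩ := h3 t
  refine ⟨x, y, WithOne.coe_injective ?_⟩
  have hee : (e.1 : WithOne S) * e.1 = e.1 := by rw [← WithOne.coe_mul, e.2.eq]
  calc (e.1 : WithOne S) = e.1 * e.1 * e.1 := by rw [hee, hee]
    _ = e.1 * (s * a * t) * e.1 := by rw [← hst]
    _ = ((x * a * y : S) : WithOne S) := by
      rw [WithOne.coe_mul, WithOne.coe_mul, hx, hy]; simp only [mul_assoc]

theorem greenJ_of_eq_mul_mul {a b x y z w : S} (h : a = x * b * y) (h' : b = z * a * w) :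
    GreenJ a b := by
  have h1 := congrArg (fun s : S => (s : WithOne S)) h
  have h2 := congrArg (fun s : S => (s : WithOne S)) h'
  simp only [WithOne.coe_mul] at h1 h2
  ext c
  constructor
  · rintro ⟨s, t, rfl⟩
    exact ⟨s * x, y * t, by rw [h1]; simp only [mul_assoc]⟩
  · rintro ⟨s, t, rfl⟩
    exact ⟨s * z, w * t, by rw [h2]; simp only [mul_assoc]⟩

/-- Stability: an element of `Se` that is `J`-above the idempotent `e` is `L`-related to `e`. -/
theorem greenL_of_eq_mul_mul [Finite S] (e : Idempotents S) {x y z : S} (hy : y * e.1 = y)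
    (h : e.1 = x * y * z) : GreenL y e.1 := by
  refine (greenL_idempotent_iff e).2 ⟨hy, e.1 * z * e.1 * (e.1 * x), ?_⟩
  -- As `ye = y`, the relation `e = xyz` reads `(exy)(eze) = e`. Swapping the two factors leaves `y`
  -- on the right, so `y` has a left multiple equal to `e`.
  have key : e.1 * z * e.1 * (e.1 * x * y) = e.1 := by
    refine mul_eq_idempotent_symm e.2.eq (by rw [mul_assoc, hy]) ?_ ?_
    · rw [mul_assoc e.1, ← mul_assoc e.1 e.1, e.2.eq]
    · calc e.1 * x * y * (e.1 * z * e.1) = e.1 * (x * (y * e.1) * z) * e.1 := by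
            simp only [mul_assoc]
        _ = e.1 := by rw [hy, ← h, e.2.eq, e.2.eq]
  rw [mul_assoc, key]

/-- Stability: an element of `eSe` that is `J`-above the idempotent `e` belongs to `G_e`. -/
theorem greenH_of_eq_mul_mul [Finite S] (e : Idempotents S) {x y u : S} (hu : e.1 * u = u)
    (hu' : u * e.1 = u) (h : e.1 = x * u * y) : GreenH u e.1 := by
  obtain ⟨-, t, ht⟩ := (greenL_idempotent_iff e).1 (greenL_of_eq_mul_mul e hu' h)
  have h1 : e.1 * t * e.1 * u = e.1 := by rw [mul_assoc, hu, mul_assoc, ht, e.2.eq]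
  have h2 : e.1 * (e.1 * t * e.1) = e.1 * t * e.1 := by simp only [← mul_assoc, e.2.eq]
  have h3 : e.1 * t * e.1 * e.1 = e.1 * t * e.1 := by rw [mul_assoc, e.2.eq]
  -- `ete` is a left inverse of `u` inside `eSe`; by finiteness it is two-sided.
  exact (greenH_idem_iff e).2 ⟨hu, hu', _, h2, h3, mul_eq_idempotent_symm e.2.eq h3 hu h1, h1⟩

end FiniteSemigroup

/-! ### Projections, idempotents and `L`-classes under right restriction and EI. -/

namespace Ehresmann

variable {S : Type u} [Semigroup S] [Ehresmann S]

theorem mul_proj_eq_iff {a f : S} (hf : f ∈ proj (S := S)) :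
    a * f = a ↔ star a * f = star a := (lTilde_star a f hf).symm

theorem proj_mul_eq_iff {a f : S} (hf : f ∈ proj (S := S)) :
    f * a = a ↔ f * plus a = plus a := (rTilde_plus a f hf).symm

theorem plus_congr {a b : S} (h : ∀ f ∈ proj (S := S), f * a = a ↔ f * b = b) :
    plus a = plus b :=
  eq_plus (plus_mem a) fun f hf => (rTilde_plus a f hf).trans (h f hf)

theorem star_congr {a b : S} (h : ∀ f ∈ proj (S := S), a * f = a ↔ b * f = b) :
    star a = star b :=
  eq_star (star_mem a) fun f hf => (lTilde_star a f hf).trans (h f hf)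

theorem proj_antisymm {f g : S} (hf : f ∈ proj (S := S)) (hg : g ∈ proj (S := S))
    (h : f * g = f) (h' : g * f = g) : f = g := by
  rw [← h, proj_comm f hf g hg, h']

/-- Projections are ordered by `f ≤ g` iff `fg = f`. Inductions on ranges and choices of minimal
projections use the strict part of this order. -/
theorem wellFounded_proj [Finite S] : WellFounded fun f g : S =>
    f * g = f ∧ f ≠ g ∧ f ∈ proj (S := S) ∧ g ∈ proj (S := S) := by
  refine @Finite.wellFounded_of_trans_of_irrefl S _ _ ⟨?_⟩ ⟨fun a h => h.2.1 rfl⟩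
  rintro a b c ⟨h1, h2, h3, h4⟩ ⟨h5, -, -, h8⟩
  refine ⟨by rw [← h1, mul_assoc, h5], fun hac => ?_, h3, h8⟩
  subst hac
  exact h2 (proj_antisymm h3 h4 h1 h5)

theorem IsEI.exists_inverse (hEI : IsEI S) {a p : S} (hp : p ∈ proj (S := S)) (hs : star a = p)
    (ha : plus a = p) : ∃ b, star b = p ∧ plus b = p ∧ a * b = p ∧ b * a = p := by
  let P : Obj S := ⟨p, hp⟩
  let α : P ⟶ P := (⟨a, hs, ha⟩ : Hom P P)
  have := hEI P α
  let β : Hom P P := CategoryTheory.inv α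
  exact ⟨β.val, β.star_eq, β.plus_eq,
    congrArg Hom.val (CategoryTheory.IsIso.inv_hom_id α),
    congrArg Hom.val (CategoryTheory.IsIso.hom_inv_id α)⟩

/-- An idempotent `e` is `R`-related to the projection `e⁺`. -/
theorem idempotent_mul_plus (hright : IsRightRestriction S) (hEI : IsEI S) (e : Idempotents S) :
    e.1 * plus e.1 = plus e.1 := by
  obtain ⟨p, hp⟩ : ∃ p, p = plus e.1 := ⟨_, rfl⟩
  rw [← hp]
  have hpm : p ∈ proj (S := S) := hp ▸ plus_mem e.1
  have hpe : p * e.1 = e.1 := by rw [hp, plus_mul]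
  have hpp : p * p = p := proj_idem p hpm
  -- `ep` is idempotent with range `p`. Once its domain is also `p`, EI makes it an invertible
  -- idempotent endomorphism of `p`, hence the identity `p`.
  set a := e.1 * p with ha
  have haa : a * a = a := by
    rw [ha, mul_assoc, ← mul_assoc p, hpe, ← mul_assoc, e.2.eq]
  have hap : plus a = p := by
    rw [hp]
    refine plus_congr fun f _ => ⟨fun h => ?_, fun h => by rw [ha, ← mul_assoc, h]⟩
    have := congrArg (· * e.1) h
    simpa only [ha, mul_assoc, hpe, e.2.eq] using this
  set r := star a with hr
  have har : a * r = a := mul_star a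
  have hrs : star (r * a) = r := by
    refine (proj_antisymm (star_mem a) (star_mem _) ?_ ?_).symm
    · rw [← mul_proj_eq_iff (star_mem _)]
      calc a * star (r * a) = a * r * a * star (r * a) := by rw [har, haa]
        _ = a * (r * a * star (r * a)) := by simp only [mul_assoc]
        _ = a := by rw [mul_star, ← mul_assoc, har, haa]
    · rw [← mul_proj_eq_iff (star_mem _), mul_assoc, har]
  -- Right ampleness and `(ra)* = r` give `ra = ar = a`, so `p = a⁺ ≤ r`; the other inequality comes
  -- from `ap = a`.
  have hra : r * a = a := by rw [hright a r (star_mem a), hrs, har]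
  have hrp : r = p := by
    refine proj_antisymm (star_mem _) hpm ?_ ?_
    · rw [← mul_proj_eq_iff hpm, ha, mul_assoc, hpp]
    · rw [proj_comm _ hpm _ (star_mem _), ← hap, ← proj_mul_eq_iff (star_mem _), hra]
  obtain ⟨b, -, -, -, h⟩ := hEI.exists_inverse hpm hrp hap
  calc a = p * a := by rw [ha, ← mul_assoc, hpe]
    _ = p := by rw [← h, mul_assoc, haa]

/-- If `tx = e`, then `t` carries `xe⁺` to `ee⁺ = e⁺`, so both are fixed on the right by the same
projections. Passing from `x` to `xe⁺` thus gives all of `L(e)` a common domain, to which right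
ampleness applies. -/
theorem star_mul_plus (hright : IsRightRestriction S) (hEI : IsEI S) {e : Idempotents S} {x : S}
    (hx : GreenL x e.1) : star (x * plus e.1) = plus e.1 := by
  obtain ⟨-, t, ht⟩ := (greenL_idempotent_iff e).1 hx
  rw [← star_of_mem (plus_mem e.1)]
  refine star_congr fun f _ => ?_
  rw [star_of_mem (plus_mem e.1)]
  constructor
  · intro h
    have := congrArg (t * ·) h
    simp only [← mul_assoc, ht, idempotent_mul_plus hright hEI] at this
    exact this
  · intro h
    rw [mul_assoc, h]

/-- A projection fixes the elements of `L(e)` that it does not move out of `L(e)`. -/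
theorem proj_mul_eq_of_greenL (hright : IsRightRestriction S) (hEI : IsEI S) {e : Idempotents S}
    {f x : S} (hf : f ∈ proj (S := S)) (hx : GreenL x e.1) (hfx : GreenL (f * x) e.1) :
    f * x = x := by
  have h1 := star_mul_plus hright hEI hx
  have h2 := star_mul_plus hright hEI hfx
  -- Both `xe⁺` and `fxe⁺` have domain `e⁺`, so ampleness gives `f(xe⁺) = xe⁺e⁺`. The factor `e⁺` is
  -- then removed by multiplying by `e`, as `e⁺e = e` and `xe = x`.
  have h3 : f * x * plus e.1 = x * plus e.1 := by
    rw [mul_assoc] at h2 ⊢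
    rw [hright _ f hf, h2, mul_assoc, proj_idem _ (plus_mem _)]
  have hxe : x * e.1 = x := ((greenL_idempotent_iff e).1 hx).1
  have h4 := congrArg (· * e.1) h3
  simp only [mul_assoc, plus_mul, hxe] at h4
  exact h4

/-- Two elements of `L(e)` with the same range differ by an element of `G_e`. -/
theorem exists_eq_mul_of_plus_eq [Finite S] (hright : IsRightRestriction S) (hEI : IsEI S)
    {e : Idempotents S} {x y : S} (hx : GreenL x e.1) (hy : GreenL y e.1) (h : plus x = plus y) :
    ∃ g : MaxSubgroup e, y = x * g.1 := by
  obtain ⟨hxe, t, ht⟩ := (greenL_idempotent_iff e).1 hx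
  obtain ⟨hye, r, hr⟩ := (greenL_idempotent_iff e).1 hy
  have hi : IsIdempotentElem (x * t) := by
    change x * t * (x * t) = x * t
    rw [mul_assoc, ← mul_assoc t, ht, ← mul_assoc, hxe]
  have hxt : plus (x * t) = plus x := plus_congr fun f _ => by
    constructor
    · intro hf
      have := congrArg (· * x) hf
      simp only [mul_assoc, ht, hxe] at this
      exact this
    · intro hf
      rw [← mul_assoc, hf]
  -- The idempotent `xt` has range `x⁺`, so `xt·x⁺ = x⁺`; applied to `y = x⁺y` this gives `y = xty`.
  have hp := idempotent_mul_plus hright hEI ⟨x * t, hi⟩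
  simp only [hxt] at hp
  have hyx : y = x * (t * y) := by
    conv_lhs => rw [← plus_mul y, ← h, ← hp]
    rw [mul_assoc, h, plus_mul, mul_assoc]
  have hg : y = x * (e.1 * t * y) := by
    rw [mul_assoc, ← mul_assoc x, hxe, ← hyx]
  -- The candidate `g = ety` lies in `eSe`, and `(rx)g = ry = e` puts it in `G_e` by stability.
  refine ⟨⟨e.1 * t * y, greenH_of_eq_mul_mul e (x := r * x) (y := e.1) ?_ ?_ ?_⟩, hg⟩
  · simp only [← mul_assoc, e.2.eq]
  · rw [mul_assoc, hye]
  · rw [mul_assoc r, ← hg, hr, e.2.eq]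

end Ehresmann

/-! ### Universal property and functoriality of the tensor product. -/

namespace BimoduleTensor

variable (A R : Type*) {M N P : Type*} [Ring A] [Ring R] [AddCommGroup M] [AddCommGroup N]
  [Module A M] [Module Rᵐᵒᵖ M] [SMulCommClass A Rᵐᵒᵖ M] [Module R N] [AddCommGroup P]

/-- The pure tensor `m ⊗ n` in `M ⊗_R N`. -/
def tmul (m : M) (n : N) : BimoduleTensor A R M N := Submodule.Quotient.mk (m ⊗ₜ[ℤ] n)

theorem op_smul_tmul (r : R) (m : M) (n : N) :
    tmul A R (MulOpposite.op r • m) n = tmul A R m (r • n) :=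
  (Submodule.Quotient.eq _).2 (Submodule.subset_span ⟨m, r, n, rfl⟩)

theorem smul_tmul (a : A) (m : M) (n : N) :
    a • tmul A R m n = tmul A R (a • m) n := rfl

theorem add_tmul (m m' : M) (n : N) :
    tmul A R (m + m') n = tmul A R m n + tmul A R m' n :=
  congrArg Submodule.Quotient.mk (TensorProduct.add_tmul m m' n)

theorem tmul_add (m : M) (n n' : N) :
    tmul A R m (n + n') = tmul A R m n + tmul A R m n' :=
  congrArg Submodule.Quotient.mk (TensorProduct.tmul_add m n n')

theorem zero_tmul (n : N) : tmul A R (0 : M) n = 0 :=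
  congrArg Submodule.Quotient.mk (TensorProduct.zero_tmul M n)

theorem tmul_zero (m : M) : tmul A R m (0 : N) = 0 :=
  congrArg Submodule.Quotient.mk (TensorProduct.tmul_zero N m)

variable {A R}

theorem induction {p : BimoduleTensor A R M N → Prop} (t : BimoduleTensor A R M N) (zero : p 0)
    (add : ∀ x y, p x → p y → p (x + y)) (tmul : ∀ m n, p (tmul A R m n)) : p t := by
  induction t using Submodule.Quotient.induction_on with
  | _ t =>
    induction t using TensorProduct.induction_on with
    | zero => exact zero
    | tmul m n => exact tmul m n
    | add x y hx hy => exact add _ _ hx hy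

/-- A balanced biadditive map factors through the tensor product. -/
def liftAdd (f : M →+ N →+ P) (hf : ∀ m (r : R) n, f (MulOpposite.op r • m) n = f m (r • n)) :
    BimoduleTensor A R M N →+ P :=
  let φ : M ⊗[ℤ] N →+ P := TensorProduct.liftAddHom f fun r m n => by
    rw [map_zsmul, map_zsmul, AddMonoidHom.zsmul_apply]
  QuotientAddGroup.lift (Submodule.toAddSubgroup (Submodule.span A
    {t : M ⊗[ℤ] N | ∃ (m : M) (r : R) (n : N),
      t = (MulOpposite.op r • m) ⊗ₜ[ℤ] n - m ⊗ₜ[ℤ] (r • n)})) φ fun t ht => by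
    -- `φ` is only additive while the relations are spanned over `A`, so the induction has to treat
    -- all `A`-multiples at once; on a generator, `a` is absorbed into the first factor.
    suffices h : ∀ a : A, φ (a • t) = 0 by simpa using h 1
    refine Submodule.span_induction (p := fun t _ => ∀ a : A, φ (a • t) = 0) ?_ ?_ ?_ ?_ ht
    · rintro _ ⟨m, r, n, rfl⟩ a
      rw [smul_sub, TensorProduct.smul_tmul', TensorProduct.smul_tmul', map_sub,
        smul_comm a (MulOpposite.op r) m]
      exact sub_eq_zero.2 (hf (a • m) r n)
    · intro a; rw [smul_zero, map_zero]
    · intro x y _ _ hx hy a; rw [smul_add, map_add, hx, hy, add_zero]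
    · intro b x _ ih a; rw [smul_smul, ih]

/-- A balanced biadditive map that is `A`-linear in the first variable factors through an
`A`-linear map on the tensor product. -/
def lift [Module A P] (f : M →+ N →+ P)
    (hf : ∀ m (r : R) n, f (MulOpposite.op r • m) n = f m (r • n))
    (hf' : ∀ (a : A) m n, f (a • m) n = a • f m n) : BimoduleTensor A R M N →ₗ[A] P where
  toFun := liftAdd f hf
  map_add' := map_add _
  map_smul' a t := by
    induction t using induction with
    | zero => rw [smul_zero, map_zero, RingHom.id_apply, smul_zero]
    | add x y hx hy => rw [smul_add, map_add, map_add, hx, hy, RingHom.id_apply, smul_add]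
    | tmul m n => exact hf' a m n

variable (A M) in
/-- `M ⊗_R -` on morphisms. -/
def map {N' : Type*} [AddCommGroup N'] [Module R N'] (φ : N →ₗ[R] N') :
    BimoduleTensor A R M N →ₗ[A] BimoduleTensor A R M N' :=
  lift (AddMonoidHom.mk' (fun m => AddMonoidHom.mk' (fun n => tmul A R m (φ n))
      fun n n' => by rw [map_add, tmul_add])
      fun m m' => AddMonoidHom.ext fun n => add_tmul A R m m' (φ n))
    (fun m r n => by
      change tmul A R _ (φ n) = tmul A R m (φ (r • n))
      rw [op_smul_tmul, map_smul])
    fun a m n => rfl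

theorem map_tmul {N' : Type*} [AddCommGroup N'] [Module R N'] (φ : N →ₗ[R] N') (m : M) (n : N) :
    map A M φ (tmul A R m n) = tmul A R m (φ n) := rfl

variable (A M) in
/-- `M ⊗_R -` on isomorphisms. -/
def congr {N' : Type*} [AddCommGroup N'] [Module R N'] (φ : N ≃ₗ[R] N') :
    BimoduleTensor A R M N ≃ₗ[A] BimoduleTensor A R M N' :=
  LinearEquiv.ofLinearMap (map A M φ) (map A M φ.symm)
    (LinearMap.ext fun t => by
      induction t using induction with
      | zero => rw [map_zero, map_zero]
      | add x y hx hy => rw [map_add, map_add, hx, hy]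
      | tmul m n =>
        rw [LinearMap.comp_apply, map_tmul, map_tmul, LinearMap.id_apply]
        exact congrArg _ (φ.apply_symm_apply n))
    (LinearMap.ext fun t => by
      induction t using induction with
      | zero => rw [map_zero, map_zero]
      | add x y hx hy => rw [map_add, map_add, hx, hy]
      | tmul m n =>
        rw [LinearMap.comp_apply, map_tmul, map_tmul, LinearMap.id_apply]
        exact congrArg _ (φ.symm_apply_apply n))

end BimoduleTensor

/-! ### Testing the action of `kS` on elements of `S`. -/

namespace SemigroupAlgebra

variable (k : Type v) [Field k] {S : Type u} [Semigroup S]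

theorem smul_mul (c : k) (a b : SemigroupAlgebra k S) : c • a * b = c • (a * b) :=
  smul_mul_assoc (β := MonoidAlgebra k S) c a b

theorem mul_smul (c : k) (a b : SemigroupAlgebra k S) : a * c • b = c • (a * b) :=
  mul_smul_comm (β := MonoidAlgebra k S) c a b

variable [Ehresmann S] [Finite S]

/-- Modules over `kS` carry no separate `k`-structure here, so a scalar has to act as the element `c
• 1` of `kS`. -/
theorem smul_eq_one_mul (c : k) (a : SemigroupAlgebra k S) : c • a = c • 1 * a := by
  rw [smul_mul, one_mul]

theorem mul_smul_eq_zero {M : Type*} [AddCommGroup M] [Module (SemigroupAlgebra k S) M]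
    {b : SemigroupAlgebra k S} {m : M} (h : ∀ s : S, (b * of k s) • m = 0)
    (a : SemigroupAlgebra k S) : (b * a) • m = 0 := by
  induction a using SemigroupAlgebra.induction with
  | zero => rw [mul_zero, zero_smul]
  | add x y hx hy => rw [mul_add, add_smul, hx, hy, add_zero]
  | smul_of c s => rw [mul_smul, smul_eq_one_mul, SemigroupAction.mul_smul, h, smul_zero]

/-- The identity of `kS` is a linear combination of elements of `S`, even though `S` need not have a
unit. -/
theorem exists_of_smul_ne_zero {M : Type*} [AddCommGroup M] [Module (SemigroupAlgebra k S) M]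
    {m : M} (hm : m ≠ 0) : ∃ s : S, of k s • m ≠ 0 := by
  by_contra! h
  apply hm
  have h1 : ∀ s : S, ((1 : SemigroupAlgebra k S) * of k s) • m = 0 := fun s => by
    rw [one_mul, h]
  have h2 := mul_smul_eq_zero k h1 1
  rwa [one_mul, one_smul] at h2

/-- Elements that act nontrivially on a simple module have a nontrivially acting product. -/
theorem exists_mul_smul_ne_zero {M : Type*} [AddCommGroup M] [Module (SemigroupAlgebra k S) M]
    [IsSimpleModule (SemigroupAlgebra k S) M] {s t : S} {m m' : M} (hs : of k s • m ≠ 0)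
    (ht : of k t • m' ≠ 0) : ∃ x : S, of k (s * x * t) • m' ≠ 0 := by
  -- By simplicity `tm'` generates `m`, say `m = atm'`; since `satm' ≠ 0`, some basis element `x`
  -- has `sxtm' ≠ 0`.
  obtain ⟨a, ha⟩ := IsSimpleModule.toSpanSingleton_surjective (SemigroupAlgebra k S) ht m
  by_contra! h
  apply hs
  rw [← ha, LinearMap.toSpanSingleton_apply, smul_smul]
  refine mul_smul_eq_zero k (fun x => ?_) a
  rw [smul_smul, ← of_mul, ← of_mul, h]

end SemigroupAlgebra

/-! ### Apexes of modules. -/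

open SemigroupAlgebra

/-- The idempotent `e` is an apex of the module `M` if it does not annihilate `M`, and lies in
the ideal generated by every element that does not annihilate `M`. -/
def IsApex (k : Type v) [Field k] {S : Type u} [Semigroup S] [Ehresmann S] [Finite S]
    (e : Idempotents S) (M : Type w) [AddCommGroup M] [Module (SemigroupAlgebra k S) M] : Prop :=
  (∃ m : M, of k e.1 • m ≠ 0) ∧ ∀ s : S, (∃ m : M, of k s • m ≠ 0) → ∃ x y, e.1 = x * s * y

namespace IsApex

variable {k : Type v} [Field k] {S : Type u} [Semigroup S] [Ehresmann S] [Finite S]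
  {e f : Idempotents S} {M : Type*} [AddCommGroup M] [Module (SemigroupAlgebra k S) M]

theorem greenJ (he : IsApex k e M) (hf : IsApex k f M) : GreenJ e.1 f.1 := by
  obtain ⟨x, y, h⟩ := he.2 _ hf.1
  obtain ⟨z, w, h'⟩ := hf.2 _ he.1
  exact greenJ_of_eq_mul_mul h h'

theorem of_greenJ (he : IsApex k e M) (h : GreenJ f.1 e.1) : IsApex k f M := by
  obtain ⟨x, y, hxy⟩ := h.exists_eq_mul_mul
  obtain ⟨z, w, hzw⟩ := GreenJ.exists_eq_mul_mul (e := e) (Eq.symm h)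
  constructor
  · obtain ⟨m, hm⟩ := he.1
    refine ⟨of k w • m, fun h0 => hm ?_⟩
    rw [hzw, mul_assoc, of_mul, of_mul, SemigroupAction.mul_smul, SemigroupAction.mul_smul, h0,
      smul_zero]
  · intro s hs
    obtain ⟨a, b, hab⟩ := he.2 s hs
    exact ⟨x * a, b * y, by rw [hxy, hab]; simp only [mul_assoc]⟩

theorem congr {N : Type*} [AddCommGroup N] [Module (SemigroupAlgebra k S) N]
    (he : IsApex k e M) (φ : M ≃ₗ[SemigroupAlgebra k S] N) : IsApex k e N := by
  constructor
  · obtain ⟨m, hm⟩ := he.1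
    refine ⟨φ m, ?_⟩
    rwa [← map_smul, Ne, φ.map_eq_zero_iff]
  · rintro s ⟨n, hn⟩
    refine he.2 s ⟨φ.symm n, ?_⟩
    rwa [← map_smul, Ne, φ.symm.map_eq_zero_iff]

/-- An element acting nontrivially is `J`-above the apex, and stability then puts it in `L(e)`, or
in `G_e` if it lies in `eSe`. -/
theorem smul_eq_zero (he : IsApex k e M) {y : S} (hy : y * e.1 = y) (h : ¬ GreenL y e.1) (m : M) :
    of k y • m = 0 := by
  by_contra hm
  obtain ⟨x, z, hxz⟩ := he.2 y ⟨m, hm⟩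
  exact h (greenL_of_eq_mul_mul e hy hxz)

theorem smul_eq_zero' (he : IsApex k e M) {u : S} (hu : e.1 * u = u) (hu' : u * e.1 = u)
    (h : ¬ GreenH u e.1) (m : M) : of k u • m = 0 := by
  by_contra hm
  obtain ⟨x, z, hxz⟩ := he.2 u ⟨m, hm⟩
  exact h (greenH_of_eq_mul_mul e hu hu' hxz)

end IsApex

open Ehresmann in
/-- A simple module of a finite EI-Ehresmann semigroup has an apex. -/
theorem Ehresmann.exists_isApex {k : Type v} [Field k] {S : Type u} [Semigroup S] [Ehresmann S]
    [Finite S] (hEI : Ehresmann.IsEI S) (M : Type*) [AddCommGroup M]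
    [Module (SemigroupAlgebra k S) M] [IsSimpleModule (SemigroupAlgebra k S) M] :
    ∃ p : Idempotents S, IsApex k p M := by
  have hM := IsSimpleModule.nontrivial (SemigroupAlgebra k S) M
  have hne : {p : S | p ∈ proj (S := S) ∧ ∃ m : M, of k p • m ≠ 0}.Nonempty := by
    obtain ⟨m, hm⟩ := exists_ne (0 : M)
    obtain ⟨s, hs⟩ := exists_of_smul_ne_zero k (S := S) hm
    refine ⟨star s, star_mem s, m, fun h => hs ?_⟩
    rw [← mul_star s, of_mul, SemigroupAction.mul_smul, h, smul_zero]
  -- The apex is a minimal projection among those that do not annihilate `M`.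
  obtain ⟨p, ⟨hp, m, hm⟩, hmin⟩ := wellFounded_proj.has_min _ hne
  refine ⟨⟨p, proj_idem p hp⟩, ⟨m, hm⟩, fun s ⟨m', hs⟩ => ?_⟩
  obtain ⟨x, hx⟩ := exists_mul_smul_ne_zero k hm hs
  obtain ⟨y, hy⟩ := exists_mul_smul_ne_zero k hx hm
  -- As `pa = a = ap`, both `a*` and `a⁺` are at most `p`. Neither annihilates `M`, because `a` does
  -- not, so minimality makes both equal to `p`. Then EI inverts `a`, which places `p` in `SsS`.
  obtain ⟨a, ha⟩ : ∃ a, a = p * x * s * y * p := ⟨_, rfl⟩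
  rw [← ha] at hy
  have hap : a * p = a := by rw [ha, mul_assoc, proj_idem p hp]
  have hpa : p * a = a := by rw [ha]; simp only [← mul_assoc, proj_idem p hp]
  have hs : star a = p := by
    by_contra hne
    refine hmin (star a) ⟨star_mem a, m, fun h => hy ?_⟩
      ⟨(mul_proj_eq_iff hp).1 hap, hne, star_mem a, hp⟩
    rw [← mul_star a, of_mul, SemigroupAction.mul_smul, h, smul_zero]
  have hpl : plus a = p := by
    by_contra hne
    refine hmin (plus a) ⟨plus_mem a, of k a • m, fun h => hy ?_⟩
      ⟨by rw [proj_comm _ (plus_mem a) _ hp, ← proj_mul_eq_iff hp, hpa], hne, plus_mem a, hp⟩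
    rw [← h, smul_smul, ← of_mul, plus_mul]
  obtain ⟨b, -, -, -, hb⟩ := hEI.exists_inverse hp hs hpl
  exact ⟨b * (p * x), y * p, hb.symm.trans (by rw [ha]; simp only [mul_assoc])⟩

/-! ### Actions on the basis of `kL(e)`. -/

namespace SchutzenbergerModule

variable (k : Type v) [Field k] {S : Type u} [Semigroup S] {e : Idempotents S}

theorem induction {p : SchutzenbergerModule k e → Prop} (m : SchutzenbergerModule k e)
    (zero : p 0) (add : ∀ x y, p x → p y → p (x + y))
    (smul_of : ∀ (c : k) (x : LClass e), p (c • of k x)) : p m := by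
  refine Finsupp.induction_linear (motive := p) m zero add fun x c => ?_
  have h : c • of k x = (Finsupp.single x c : LClass e →₀ k) :=
    (Finsupp.smul_single c x 1).trans (by rw [smul_eq_mul, mul_one])
  exact h ▸ smul_of c x

theorem op_single_smul (g : MaxSubgroup e) (c : k) (m : SchutzenbergerModule k e) :
    MulOpposite.op (MonoidAlgebra.single g c) • m = c • rightTranslate k e g m := by
  rw [op_smul_def, rightAction, MonoidAlgebra.lift_single]
  rfl

theorem op_single_smul_of (g : MaxSubgroup e) (x : LClass e) :
    MulOpposite.op (MonoidAlgebra.single g (1 : k)) • of k x = of k (translate e g x) := by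
  rw [op_single_smul, rightTranslate_of, one_smul]

theorem op_single_one_smul (c : k) (m : SchutzenbergerModule k e) :
    MulOpposite.op (MonoidAlgebra.single (1 : MaxSubgroup e) c) • m = c • m := by
  rw [op_single_smul]
  congr 1
  exact LinearMap.congr_fun (congrArg MulOpposite.unop (map_one (rightMul k e))) m

variable [Ehresmann S] [Finite S]

theorem of_smul (s : S) (m : SchutzenbergerModule k e) :
    SemigroupAlgebra.of k s • m = leftMul k e s m := by
  rw [smul_def, leftAction_of]

theorem of_smul_of {s : S} {x : LClass e} (h : GreenL (s * x.1) e.1) :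
    SemigroupAlgebra.of k s • of k x = of k (⟨s * x.1, h⟩ : LClass e) := by
  rw [of_smul, leftMul_of_pos k e h]

theorem of_smul_of_eq_zero {s : S} {x : LClass e} (h : ¬ GreenL (s * x.1) e.1) :
    SemigroupAlgebra.of k s • of k x = 0 := by
  rw [of_smul, leftMul_of_neg k e h]

end SchutzenbergerModule

open SchutzenbergerModule

/-- The idempotent `e` as an element of its `L`-class. -/
def LClass.base {S : Type u} [Semigroup S] (e : Idempotents S) : LClass e :=
  ⟨e.1, GreenL.refl _⟩

/-! ### The group algebra `kG_e` inside `kS`. -/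

section GroupMap

variable (k : Type v) [Field k] {S : Type u} [Semigroup S] (e : Idempotents S)

/-- The inclusion of `kG_e` into `kS`, which need not preserve the identity. -/
def groupMap : MonoidAlgebra k (MaxSubgroup e) →ₙₐ[k] SemigroupAlgebra k S :=
  (MonoidAlgebra.liftMagma k
    (⟨fun g => SemigroupAlgebra.of k g.1, fun g h => SemigroupAlgebra.of_mul k g.1 h.1⟩ :
      MaxSubgroup e →ₙ* MonoidAlgebra k S) :
    MonoidAlgebra k (MaxSubgroup e) →ₙₐ[k] MonoidAlgebra k S)

theorem groupMap_single (g : MaxSubgroup e) (c : k) :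
    groupMap k e (MonoidAlgebra.single g c) = c • SemigroupAlgebra.of k g.1 := by
  change (MonoidAlgebra.liftMagma k
    (⟨fun g => SemigroupAlgebra.of k g.1, fun g h => SemigroupAlgebra.of_mul k g.1 h.1⟩ :
      MaxSubgroup e →ₙ* MonoidAlgebra k S)) (MonoidAlgebra.single g c) = _
  simp
  rfl

theorem groupMap_one : groupMap k e 1 = SemigroupAlgebra.of k e.1 := by
  rw [MonoidAlgebra.one_def, groupMap_single, one_smul, MaxSubgroup.coe_one]

variable {e} [Ehresmann S] [Finite S]

theorem groupMap_single_smul (g : MaxSubgroup e) (c : k) (m : SchutzenbergerModule k e) :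
    groupMap k e (MonoidAlgebra.single g c) • m = c • leftMul k e g.1 m := by
  rw [groupMap_single, smul_def, map_smul, leftAction_of]
  rfl

/-- From `ge = g = eg`, the two actions of `G_e` agree at `e`. This makes `v ↦ e ⊗ v` linear over
`kG_e`. -/
theorem groupMap_smul_base (r : MonoidAlgebra k (MaxSubgroup e)) :
    groupMap k e r • SchutzenbergerModule.of k (LClass.base e) =
      MulOpposite.op r • SchutzenbergerModule.of k (LClass.base e) := by
  induction r using MonoidAlgebra.induction_linear with
  | zero => rw [map_zero, zero_smul, MulOpposite.op_zero, zero_smul]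
  | add x y hx hy => rw [map_add, add_smul, MulOpposite.op_add, add_smul, hx, hy]
  | single g c =>
    obtain ⟨h1, h2, -⟩ := (greenH_idem_iff e).1 g.2
    have h : g.1 * (LClass.base e).1 = g.1 := h2
    rw [groupMap_single_smul, op_single_smul, rightTranslate_of,
      leftMul_of_pos k e (by rw [h]; exact g.2.2)]
    congr 2
    exact Subtype.ext (h2.trans h1.symm)

end GroupMap

/-! ### The projection of `kL(e)` onto `kG_e`. -/

section GroupPart

variable (k : Type v) [Field k] {S : Type u} [Semigroup S] {e : Idempotents S}

open Classical in
variable (e) in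
/-- The linear map `kL(e) → kG_e` sending `x` to `ex` if `ex ∈ G_e`, and to `0` otherwise. -/
def groupPart : SchutzenbergerModule k e →ₗ[k] MonoidAlgebra k (MaxSubgroup e) :=
  Finsupp.linearCombination k fun x : LClass e =>
    if h : GreenH (e.1 * x.1) e.1 then
      (MonoidAlgebra.single ⟨e.1 * x.1, h⟩ 1 : MonoidAlgebra k (MaxSubgroup e)) else 0

theorem groupPart_of_pos {x : LClass e} (h : GreenH (e.1 * x.1) e.1) :
    groupPart k e (of k x) = MonoidAlgebra.single ⟨e.1 * x.1, h⟩ 1 := by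
  classical
  have := Finsupp.linearCombination_single k (v := fun x : LClass e =>
    if h : GreenH (e.1 * x.1) e.1 then
      (MonoidAlgebra.single ⟨e.1 * x.1, h⟩ 1 : MonoidAlgebra k (MaxSubgroup e)) else 0) 1 x
  rw [one_smul, dif_pos h] at this
  exact this

theorem groupPart_of_neg {x : LClass e} (h : ¬ GreenH (e.1 * x.1) e.1) :
    groupPart k e (of k x) = 0 := by
  classical
  have := Finsupp.linearCombination_single k (v := fun x : LClass e =>
    if h : GreenH (e.1 * x.1) e.1 then
      (MonoidAlgebra.single ⟨e.1 * x.1, h⟩ 1 : MonoidAlgebra k (MaxSubgroup e)) else 0) 1 x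
  rw [one_smul, dif_neg h] at this
  exact this

theorem groupPart_base : groupPart k e (of k (LClass.base e)) = 1 := by
  have h : e.1 * (LClass.base e).1 = e.1 := e.2.eq
  rw [groupPart_of_pos k (by rw [h]; exact ⟨Eq.refl _, Eq.refl _⟩), MonoidAlgebra.one_def]
  congr 1
  exact Subtype.ext h

/-- Translation by `g` preserves `G_e` and is undone by `g⁻¹`. -/
theorem greenH_mul_iff (g : MaxSubgroup e) (x : S) :
    GreenH (x * g.1) e.1 ↔ GreenH (x * e.1) e.1 := by
  have hx : ∀ (g : MaxSubgroup e) (x : S), GreenH (x * e.1) e.1 → GreenH (x * g.1) e.1 := by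
    intro g x h
    have := ((⟨x * e.1, h⟩ : MaxSubgroup e) * g).2
    rwa [MaxSubgroup.coe_mul, mul_assoc, ((greenH_idem_iff e).1 g.2).1] at this
  refine ⟨fun h => ?_, hx g x⟩
  have h1 : x * g.1 * e.1 = x * g.1 := by rw [mul_assoc, ((greenH_idem_iff e).1 g.2).2.1]
  have h2 := hx g⁻¹ (x * g.1) (by rwa [h1])
  rwa [mul_assoc, ← MaxSubgroup.coe_mul, mul_inv_cancel, MaxSubgroup.coe_one] at h2

theorem mul_greenH_iff (g : MaxSubgroup e) (x : S) :
    GreenH (g.1 * x) e.1 ↔ GreenH (e.1 * x) e.1 := by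
  have hx : ∀ (g : MaxSubgroup e) (x : S), GreenH (e.1 * x) e.1 → GreenH (g.1 * x) e.1 := by
    intro g x h
    have := (g * (⟨e.1 * x, h⟩ : MaxSubgroup e)).2
    rwa [MaxSubgroup.coe_mul, ← mul_assoc, ((greenH_idem_iff e).1 g.2).2.1] at this
  refine ⟨fun h => ?_, hx g x⟩
  have h1 : e.1 * (g.1 * x) = g.1 * x := by rw [← mul_assoc, ((greenH_idem_iff e).1 g.2).1]
  have h2 := hx g⁻¹ (g.1 * x) (by rwa [h1])
  rwa [← mul_assoc, ← MaxSubgroup.coe_mul, inv_mul_cancel, MaxSubgroup.coe_one] at h2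

theorem groupPart_of_translate (g : MaxSubgroup e) (x : LClass e) :
    groupPart k e (of k (translate e g x)) = groupPart k e (of k x) * MonoidAlgebra.single g 1 := by
  have hiff : GreenH (e.1 * (translate e g x).1) e.1 ↔ GreenH (e.1 * x.1) e.1 := by
    have := greenH_mul_iff g (e.1 * x.1)
    rwa [mul_assoc, mul_assoc, mul_idem] at this
  by_cases h : GreenH (e.1 * x.1) e.1
  · rw [groupPart_of_pos k h, groupPart_of_pos k (hiff.2 h), MonoidAlgebra.single_mul_single,
      mul_one]
    congr 1
    exact Subtype.ext (mul_assoc _ _ _).symm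
  · rw [groupPart_of_neg k h, groupPart_of_neg k (mt hiff.1 h), zero_mul]

/-- Right linearity is what makes `(m, v) ↦ groupPart m • v` balanced, so that it descends to the
induced module. -/
theorem groupPart_op_smul (r : MonoidAlgebra k (MaxSubgroup e)) (m : SchutzenbergerModule k e) :
    groupPart k e (MulOpposite.op r • m) = groupPart k e m * r := by
  induction r using MonoidAlgebra.induction_linear with
  | zero => rw [MulOpposite.op_zero, zero_smul, map_zero, mul_zero]
  | add x y hx hy => rw [MulOpposite.op_add, add_smul, map_add, hx, hy, mul_add]
  | single g c =>
    induction m using SchutzenbergerModule.induction with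
    | zero => rw [smul_zero, map_zero, zero_mul]
    | add x y hx hy => rw [smul_add, map_add, map_add, hx, hy, add_mul]
    | smul_of d x =>
      have : MonoidAlgebra.single g c = c • MonoidAlgebra.single g (1 : k) := by
        rw [MonoidAlgebra.smul_single', mul_one]
      rw [op_single_smul, map_smul, map_smul, map_smul, rightTranslate_of, groupPart_of_translate,
        map_smul, this, mul_smul_comm, smul_mul_assoc]

theorem groupPart_leftMul_of (g : MaxSubgroup e) (x : LClass e) :
    groupPart k e (leftMul k e g.1 (of k x)) =
      MonoidAlgebra.single g 1 * groupPart k e (of k x) := by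
  by_cases h : GreenH (e.1 * x.1) e.1
  · have h' : GreenH (g.1 * x.1) e.1 := (mul_greenH_iff g x.1).2 h
    have h'' : e.1 * (g.1 * x.1) = g.1 * x.1 := by
      rw [← mul_assoc, ((greenH_idem_iff e).1 g.2).1]
    rw [leftMul_of_pos k e h'.2, groupPart_of_pos k h, groupPart_of_pos k (by rwa [h'']),
      MonoidAlgebra.single_mul_single, mul_one]
    congr 1
    apply Subtype.ext
    change e.1 * (g.1 * x.1) = g.1 * (e.1 * x.1)
    rw [h'', ← mul_assoc, ((greenH_idem_iff e).1 g.2).2.1]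
  · rw [groupPart_of_neg k h, mul_zero]
    by_cases h' : GreenL (g.1 * x.1) e.1
    · rw [leftMul_of_pos k e h', groupPart_of_neg]
      rwa [← mul_assoc, ((greenH_idem_iff e).1 g.2).1, mul_greenH_iff]
    · rw [leftMul_of_neg k e h', map_zero]

variable [Ehresmann S] [Finite S]

theorem groupPart_smul (r : MonoidAlgebra k (MaxSubgroup e)) (m : SchutzenbergerModule k e) :
    groupPart k e (groupMap k e r • m) = r * groupPart k e m := by
  induction r using MonoidAlgebra.induction_linear with
  | zero => rw [map_zero, zero_smul, map_zero, zero_mul]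
  | add x y hx hy => rw [map_add, add_smul, map_add, hx, hy, add_mul]
  | single g c =>
    have hc : MonoidAlgebra.single g c = c • MonoidAlgebra.single g (1 : k) := by
      rw [MonoidAlgebra.smul_single', mul_one]
    rw [groupMap_single_smul, map_smul, hc, smul_mul_assoc]
    congr 1
    induction m using SchutzenbergerModule.induction with
    | zero => rw [map_zero, map_zero, mul_zero]
    | add x y hx hy => rw [map_add, map_add, map_add, hx, hy, mul_add]
    | smul_of d x =>
      rw [map_smul, map_smul, map_smul, mul_smul_comm, groupPart_leftMul_of]

end GroupPart

/-! ### Induced modules and their simplicity. -/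

namespace InducedModule

variable (k : Type v) [Field k] {S : Type u} [Semigroup S] [Ehresmann S] [Finite S]
  {e : Idempotents S} {V : Type w} [AddCommGroup V] [Module (MonoidAlgebra k (MaxSubgroup e)) V]

/-- The element `x ⊗ v` for `x ∈ L(e)` and `v ∈ V`. -/
def pure (x : LClass e) (v : V) : InducedModule k e V :=
  BimoduleTensor.tmul (SemigroupAlgebra k S) (MonoidAlgebra k (MaxSubgroup e)) (of k x) v

theorem pure_add (x : LClass e) (v v' : V) : pure k x (v + v') = pure k x v + pure k x v' :=
  BimoduleTensor.tmul_add _ _ _ _ _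

theorem pure_zero (x : LClass e) : pure k x (0 : V) = 0 := BimoduleTensor.tmul_zero _ _ _

theorem pure_translate (g : MaxSubgroup e) (x : LClass e) (v : V) :
    pure k (translate e g x) v = pure k x ((MonoidAlgebra.single g (1 : k)) • v) := by
  rw [pure, ← op_single_smul_of, BimoduleTensor.op_smul_tmul, ← pure]

theorem of_smul_pure {s : S} {x : LClass e} (h : GreenL (s * x.1) e.1) (v : V) :
    SemigroupAlgebra.of k s • pure k x v = pure k ⟨s * x.1, h⟩ v := by
  rw [pure, BimoduleTensor.smul_tmul, of_smul_of k h, ← pure]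

theorem of_smul_pure_eq_zero {s : S} {x : LClass e} (h : ¬ GreenL (s * x.1) e.1) (v : V) :
    SemigroupAlgebra.of k s • pure k x v = 0 := by
  rw [pure, BimoduleTensor.smul_tmul, of_smul_of_eq_zero k h, BimoduleTensor.zero_tmul]

theorem induction {p : InducedModule k e V → Prop} (t : InducedModule k e V) (zero : p 0)
    (add : ∀ x y, p x → p y → p (x + y)) (pure : ∀ x v, p (pure k x v)) : p t := by
  induction t using BimoduleTensor.induction with
  | zero => exact zero
  | add x y hx hy => exact add x y hx hy
  | tmul m v =>
    induction m using SchutzenbergerModule.induction with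
    | zero => rw [BimoduleTensor.zero_tmul]; exact zero
    | add x y hx hy => rw [BimoduleTensor.add_tmul]; exact add _ _ hx hy
    | smul_of c x =>
      -- The scalar acts on the right as a multiple of the unit of `kG_e`, so it moves across the
      -- tensor sign onto `v`.
      rw [← op_single_one_smul, BimoduleTensor.op_smul_tmul]
      exact pure x _

/-- Since `xe = x`, the induced module is generated by `e ⊗ V`. -/
theorem of_smul_pure_base (x : LClass e) (v : V) :
    SemigroupAlgebra.of k x.1 • pure k (LClass.base e) v = pure k x v := by
  have h : x.1 * (LClass.base e).1 = x.1 := mul_idem x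
  rw [of_smul_pure k (by rw [h]; exact x.2)]
  congr 1
  exact Subtype.ext h

theorem groupMap_smul_pure_base (r : MonoidAlgebra k (MaxSubgroup e)) (v : V) :
    groupMap k e r • pure k (LClass.base e) v = pure k (LClass.base e) (r • v) := by
  rw [pure, BimoduleTensor.smul_tmul, groupMap_smul_base, BimoduleTensor.op_smul_tmul, ← pure]

theorem of_idem_smul_pure_base (v : V) :
    SemigroupAlgebra.of k e.1 • pure k (LClass.base e) v = pure k (LClass.base e) v :=
  of_smul_pure_base k (LClass.base e) v

variable (e V) in
/-- The coordinate in `V` of the image of an element of the induced module under `e`. -/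
def coord : InducedModule k e V →+ V :=
  BimoduleTensor.liftAdd
    (AddMonoidHom.mk' (fun m => AddMonoidHom.mk' (fun v : V => groupPart k e m • v)
      fun v v' => smul_add _ v v') fun m m' => AddMonoidHom.ext fun v => by
        change groupPart k e (m + m') • v = groupPart k e m • v + groupPart k e m' • v
        rw [map_add, add_smul])
    fun m r v => by
      change groupPart k e (MulOpposite.op r • m) • v = groupPart k e m • r • v
      rw [groupPart_op_smul, SemigroupAction.mul_smul]

theorem coord_tmul (m : SchutzenbergerModule k e) (v : V) :
    coord k e V (BimoduleTensor.tmul _ _ m v) = groupPart k e m • v := rfl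

theorem coord_pure (x : LClass e) (v : V) :
    coord k e V (pure k x v) = groupPart k e (of k x) • v := rfl

/-- In particular `e ⊗ v = 0` forces `v = 0`, which is how pure tensors are seen to be nonzero. -/
theorem coord_pure_base (v : V) : coord k e V (pure k (LClass.base e) v) = v := by
  rw [coord_pure, groupPart_base, one_smul]

theorem coord_smul (r : MonoidAlgebra k (MaxSubgroup e)) (t : InducedModule k e V) :
    coord k e V (groupMap k e r • t) = r • coord k e V t := by
  induction t using BimoduleTensor.induction with
  | zero => rw [smul_zero, map_zero, smul_zero]
  | add x y hx hy => rw [smul_add, map_add, map_add, hx, hy, smul_add]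
  | tmul m v =>
    rw [BimoduleTensor.smul_tmul, coord_tmul, coord_tmul, groupPart_smul,
      SemigroupAction.mul_smul]

/-- If `ex` stays in `L(e)`, stability makes it some `g ∈ G_e`, and `g ⊗ v = e ⊗ gv`; otherwise both
sides vanish. So `e Ind(V)` is exactly `e ⊗ V`. -/
theorem pure_base_coord (t : InducedModule k e V) :
    pure k (LClass.base e) (coord k e V t) = SemigroupAlgebra.of k e.1 • t := by
  induction t using induction with
  | zero => rw [map_zero, pure_zero, smul_zero]
  | add x y hx hy => rw [map_add, pure_add, hx, hy, smul_add]
  | pure x v =>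
    by_cases h : GreenL (e.1 * x.1) e.1
    · have h' : GreenH (e.1 * x.1) e.1 := by
        obtain ⟨-, t, ht⟩ := (greenL_idempotent_iff e).1 h
        refine greenH_of_eq_mul_mul e (x := t) (y := e.1) ?_ ?_ ?_
        · rw [← mul_assoc, e.2.eq]
        · rw [mul_assoc, mul_idem]
        · rw [ht, e.2.eq]
      rw [of_smul_pure k h, coord_pure, groupPart_of_pos k h', ← pure_translate]
      congr 1
      apply Subtype.ext
      change e.1 * (e.1 * x.1) = _
      rw [← mul_assoc, e.2.eq]
    · rw [of_smul_pure_eq_zero k h, coord_pure, groupPart_of_neg k (fun h' => h h'.2),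
        zero_smul, pure_zero]

/-- If `s` does not annihilate `Ind(V)`, then `sx ∈ L(e)` for some `x ∈ L(e)`, and `e` is a left
multiple of `sx`. -/
theorem isApex [Nontrivial V] : IsApex k e (InducedModule k e V) := by
  constructor
  · obtain ⟨v, hv⟩ := exists_ne (0 : V)
    refine ⟨pure k (LClass.base e) v, fun h => hv ?_⟩
    rw [of_idem_smul_pure_base] at h
    rw [← coord_pure_base k (e := e) v, h, map_zero]
  · rintro s ⟨t, ht⟩
    by_contra! h
    refine ht ?_
    clear ht
    induction t using induction with
    | zero => rw [smul_zero]
    | add x y hx hy => rw [smul_add, hx, hy, add_zero]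
    | pure x v =>
      refine of_smul_pure_eq_zero k (fun hL => ?_) v
      obtain ⟨-, t, ht⟩ := (greenL_idempotent_iff e).1 hL
      exact h t x.1 (ht.symm.trans (mul_assoc _ _ _).symm)

open Ehresmann

/-- An element of the induced module is a sum of pure tensors `x ⊗ v` with different `x⁺`. -/
theorem exists_eq_sum (hright : IsRightRestriction S) (hEI : IsEI S) [Fintype S]
    (t : InducedModule k e V) : ∃ c : S → InducedModule k e V, t = ∑ f, c f ∧
      ∀ f, c f = 0 ∨ ∃ x : LClass e, plus x.1 = f ∧ ∃ v, c f = pure k x v := by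
  classical
  induction t using induction with
  | zero => exact ⟨0, by simp, fun f => Or.inl rfl⟩
  | add t t' ht ht' =>
    obtain ⟨c, hc, hc'⟩ := ht
    obtain ⟨d, hd, hd'⟩ := ht'
    refine ⟨c + d, by rw [hc, hd]; simp [Finset.sum_add_distrib], fun f => ?_⟩
    rcases hc' f with h | ⟨x, hx, v, hv⟩
    · rw [Pi.add_apply, h, zero_add]
      exact hd' f
    · rcases hd' f with h' | ⟨y, hy, w, hw⟩
      · rw [Pi.add_apply, h', add_zero]
        exact Or.inr ⟨x, hx, v, hv⟩
      -- Terms with equal range merge: `y = xg` gives `y ⊗ w = x ⊗ gw`.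
      · obtain ⟨g, hg⟩ := exists_eq_mul_of_plus_eq hright hEI x.2 y.2 (hx.trans hy.symm)
        have : y = translate e g x := Subtype.ext hg
        refine Or.inr ⟨x, hx, v + MonoidAlgebra.single g (1 : k) • w, ?_⟩
        rw [Pi.add_apply, hv, hw, this, pure_translate, pure_add]
  | pure x v =>
    refine ⟨Pi.single (plus x.1) (pure k x v), by simp, fun f => ?_⟩
    by_cases h : plus x.1 = f
    · subst h
      exact Or.inr ⟨x, rfl, v, by simp⟩
    · exact Or.inl (Pi.single_eq_of_ne (Ne.symm h) _)

/-- The radical of the induced module vanishes. -/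
theorem eq_zero_of_coord (hright : IsRightRestriction S) (hEI : IsEI S)
    (t : InducedModule k e V) (h : ∀ s : S, coord k e V (SemigroupAlgebra.of k s • t) = 0) :
    t = 0 := by
  have := Fintype.ofFinite S
  obtain ⟨c, hc, hc'⟩ := exists_eq_sum k hright hEI t
  suffices h0 : ∀ f, c f = 0 by rw [hc, Finset.sum_eq_zero fun f _ => h0 f]
  intro f
  -- Induction along the order of projections: the terms of strictly smaller range already vanish.
  induction f using (wellFounded_proj (S := S)).induction with
  | _ f ih =>
    rcases hc' f with h1 | ⟨x, rfl, v, hv⟩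
    · exact h1
    -- Multiplication by `f = x⁺` isolates the term of range `f`: it kills `y ⊗ w` unless `fy ∈
    -- L(e)`, and then `fy = y`, so `y⁺ ≤ f` and the term is zero or is the one of range `f`.
    have key : SemigroupAlgebra.of k (plus x.1) • t = pure k x v := by
      rw [hc, Finset.smul_sum, Finset.sum_eq_single (plus x.1)]
      · rw [hv, of_smul_pure k (by rw [plus_mul]; exact x.2)]
        congr 1
        exact Subtype.ext (plus_mul x.1)
      · intro g _ hg
        rcases hc' g with h1 | ⟨y, rfl, w, hw⟩
        · rw [h1, smul_zero]
        · by_cases hL : GreenL (plus x.1 * y.1) e.1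
          · have h2 := proj_mul_eq_of_greenL hright hEI (plus_mem x.1) y.2 hL
            rw [proj_mul_eq_iff (plus_mem _), proj_comm _ (plus_mem _) _ (plus_mem _)] at h2
            rw [ih _ ⟨h2, hg, plus_mem _, plus_mem _⟩, smul_zero]
          · rw [hw, of_smul_pure_eq_zero k hL]
      · simp
    obtain ⟨-, s, hs⟩ := (greenL_idempotent_iff e).1 x.2
    -- With `sx = e`, the element `s x⁺` sends `t` to `e ⊗ v`, whose coordinate is `v`.
    have h2 := h (s * plus x.1)
    rw [SemigroupAlgebra.of_mul, SemigroupAction.mul_smul, key,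
      of_smul_pure k (by rw [hs]; exact GreenL.refl _)] at h2
    have h3 : (⟨s * x.1, by rw [hs]; exact GreenL.refl _⟩ : LClass e) = LClass.base e :=
      Subtype.ext hs
    rw [h3, coord_pure_base] at h2
    rw [hv, h2, pure_zero]

/-- The induced module of a simple module is simple. -/
theorem isSimpleModule (hright : IsRightRestriction S) (hEI : IsEI S)
    [IsSimpleModule (MonoidAlgebra k (MaxSubgroup e)) V] :
    IsSimpleModule (SemigroupAlgebra k S) (InducedModule k e V) := by
  have hV := IsSimpleModule.nontrivial (MonoidAlgebra k (MaxSubgroup e)) V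
  rw [isSimpleModule_iff_toSpanSingleton_surjective]
  constructor
  · obtain ⟨v, hv⟩ := (isApex k (e := e) (V := V)).1
    exact ⟨_, _, hv⟩
  intro t ht
  rw [← LinearMap.range_eq_top, eq_top_iff]
  set N := LinearMap.range (LinearMap.toSpanSingleton (SemigroupAlgebra k S) _ t) with hN
  have htN : t ∈ N := ⟨1, one_smul _ _⟩
  obtain ⟨s, hs⟩ : ∃ s : S, coord k e V (SemigroupAlgebra.of k s • t) ≠ 0 := by
    by_contra! h
    exact ht (eq_zero_of_coord k hright hEI t h)
  obtain ⟨v, hv⟩ : ∃ v, v = coord k e V (SemigroupAlgebra.of k s • t) := ⟨_, rfl⟩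
  rw [← hv] at hs
  -- The submodule generated by `t` contains `e ⊗ v` with `v ≠ 0`; simplicity of `V` then gives `e ⊗
  -- V`, and multiplication by `L(e)` gives everything.
  have hvN : pure k (LClass.base e) v ∈ N := by
    rw [hv, pure_base_coord]
    exact N.smul_mem _ (N.smul_mem _ htN)
  intro m _
  induction m using induction with
  | zero => exact N.zero_mem
  | add x y hx hy => exact N.add_mem (hx trivial) (hy trivial)
  | pure x w =>
    obtain ⟨r, rfl⟩ := IsSimpleModule.toSpanSingleton_surjective (MonoidAlgebra k (MaxSubgroup e))
      hs w
    rw [← of_smul_pure_base]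
    rw [LinearMap.toSpanSingleton_apply, ← groupMap_smul_pure_base]
    exact N.smul_mem _ (N.smul_mem _ hvN)

end InducedModule

/-! ### The corner `eM` as a `kG_e`-module. -/

/-- The subspace `eM` of a `kS`-module `M`. -/
def Corner (k : Type v) [Field k] {S : Type u} [Semigroup S] [Ehresmann S] [Finite S]
    (e : Idempotents S) (M : Type w) [AddCommGroup M] [Module (SemigroupAlgebra k S) M] :
    AddSubgroup M where
  carrier := {m | of k e.1 • m = m}
  add_mem' {x y} hx hy := (smul_add _ x y).trans (congrArg₂ (· + ·) hx hy)
  zero_mem' := smul_zero _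
  neg_mem' {x} hx := (smul_neg _ x).trans (congrArg (- ·) hx)

namespace Corner

variable {k : Type v} [Field k] {S : Type u} [Semigroup S] [Ehresmann S] [Finite S]
  {e : Idempotents S} {M : Type w} [AddCommGroup M] [Module (SemigroupAlgebra k S) M]

theorem of_smul (v : Corner k e M) : of k e.1 • (v : M) = v := v.2

theorem of_smul_mem (m : M) : of k e.1 • m ∈ Corner k e M := by
  change of k e.1 • of k e.1 • m = of k e.1 • m
  rw [smul_smul, ← of_mul, e.2.eq]

theorem groupMap_smul_mem (r : MonoidAlgebra k (MaxSubgroup e)) (m : M) :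
    groupMap k e r • m ∈ Corner k e M := by
  change of k e.1 • groupMap k e r • m = groupMap k e r • m
  rw [smul_smul, ← groupMap_one, ← map_mul, one_mul]

/-- `eM` is a `kG_e`-module. -/
instance : Module (MonoidAlgebra k (MaxSubgroup e)) (Corner k e M) where
  smul r v := ⟨groupMap k e r • (v : M), groupMap_smul_mem r (v : M)⟩
  one_smul v := Subtype.ext (by
    change groupMap k e 1 • (v : M) = (v : M)
    rw [groupMap_one, of_smul])
  mul_smul r s v := Subtype.ext (by
    change groupMap k e (r * s) • (v : M) = groupMap k e r • groupMap k e s • (v : M)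
    rw [map_mul, SemigroupAction.mul_smul])
  smul_zero r := Subtype.ext (smul_zero (groupMap k e r))
  smul_add r v w := Subtype.ext (smul_add (groupMap k e r) (v : M) w)
  add_smul r s v := Subtype.ext (by
    change groupMap k e (r + s) • (v : M) = groupMap k e r • (v : M) + groupMap k e s • (v : M)
    rw [map_add, add_smul])
  zero_smul v := Subtype.ext (by
    change groupMap k e 0 • (v : M) = 0
    rw [map_zero, zero_smul])

theorem coe_smul (r : MonoidAlgebra k (MaxSubgroup e)) (v : Corner k e M) :
    ((r • v : Corner k e M) : M) = groupMap k e r • (v : M) := rfl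

/-- At an apex `e`, the algebra `e(kS)e` acts on `eM` through `kG_e`. -/
theorem exists_of_smul_smul_eq (he : IsApex k e M) (a : SemigroupAlgebra k S) :
    ∃ r : MonoidAlgebra k (MaxSubgroup e), ∀ v : Corner k e M,
      of k e.1 • a • (v : M) = ((r • v : Corner k e M) : M) := by
  induction a using SemigroupAlgebra.induction with
  | zero => exact ⟨0, fun v => by rw [zero_smul, smul_zero, zero_smul]; rfl⟩
  | add x y hx hy =>
    obtain ⟨r, hr⟩ := hx
    obtain ⟨s, hs⟩ := hy
    exact ⟨r + s, fun v => by rw [add_smul, smul_add, hr, hs, add_smul]; rfl⟩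
  | smul_of c s =>
    have key : ∀ v : Corner k e M, of k e.1 • (c • of k s) • (v : M) =
        (c • of k (e.1 * s * e.1)) • (v : M) := fun v => by
      rw [← of_smul v, smul_smul, smul_smul, SemigroupAlgebra.mul_smul, SemigroupAlgebra.smul_mul,
        ← of_mul, ← of_mul, of_smul]
    have h1 : e.1 * (e.1 * s * e.1) = e.1 * s * e.1 := by simp only [← mul_assoc, e.2.eq]
    have h2 : e.1 * s * e.1 * e.1 = e.1 * s * e.1 := by rw [mul_assoc, e.2.eq]
    -- By stability, `ese` belongs to `G_e` or annihilates `M`.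
    by_cases h : GreenH (e.1 * s * e.1) e.1
    · exact ⟨MonoidAlgebra.single ⟨_, h⟩ c, fun v => by rw [key, coe_smul, groupMap_single]⟩
    · refine ⟨0, fun v => ?_⟩
      rw [key, smul_eq_one_mul, SemigroupAction.mul_smul, he.smul_eq_zero' h1 h2 h, smul_zero,
        zero_smul]
      rfl

theorem nontrivial (he : IsApex k e M) : Nontrivial (Corner k e M) := by
  obtain ⟨m, hm⟩ := he.1
  exact ⟨⟨_, of_smul_mem m⟩, 0, fun h => hm (congrArg Subtype.val h)⟩

/-- If `w = av` with `v, w ∈ eM`, then `w = eav`, and at an apex `ea` acts on `eM` as an element of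
`kG_e`. -/
theorem isSimpleModule [IsSimpleModule (SemigroupAlgebra k S) M] (he : IsApex k e M) :
    IsSimpleModule (MonoidAlgebra k (MaxSubgroup e)) (Corner k e M) := by
  rw [isSimpleModule_iff_toSpanSingleton_surjective]
  refine ⟨nontrivial he, fun v hv w => ?_⟩
  obtain ⟨a, ha⟩ := IsSimpleModule.toSpanSingleton_surjective (SemigroupAlgebra k S)
    (fun h : (v : M) = 0 => hv (Subtype.ext h)) (w : M)
  obtain ⟨r, hr⟩ := exists_of_smul_smul_eq he a
  refine ⟨r, Subtype.ext ?_⟩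
  rw [LinearMap.toSpanSingleton_apply, ← hr]
  rw [LinearMap.toSpanSingleton_apply] at ha
  rw [ha, of_smul]

end Corner

/-! ### The comparison map `Ind(eM) → M`. -/

section Counit

open SchutzenbergerModule

variable (k : Type v) [Field k] {S : Type u} [Semigroup S] (e : Idempotents S)

/-- The linear map `kL(e) → kS` induced by the inclusion of `L(e)` into `S`. -/
def inclusion : SchutzenbergerModule k e →ₗ[k] SemigroupAlgebra k S :=
  Finsupp.linearCombination k fun x : LClass e => SemigroupAlgebra.of k x.1

theorem inclusion_of (x : LClass e) :
    inclusion k e (SchutzenbergerModule.of k x) = SemigroupAlgebra.of k x.1 := by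
  have := Finsupp.linearCombination_single k
    (v := fun x : LClass e => SemigroupAlgebra.of k x.1) 1 x
  rw [one_smul] at this
  exact this

theorem inclusion_op_smul (r : MonoidAlgebra k (MaxSubgroup e)) (m : SchutzenbergerModule k e) :
    inclusion k e (MulOpposite.op r • m) = inclusion k e m * groupMap k e r := by
  induction r using MonoidAlgebra.induction_linear with
  | zero => rw [MulOpposite.op_zero, zero_smul, map_zero, map_zero, mul_zero]
  | add x y hx hy => rw [MulOpposite.op_add, add_smul, map_add, map_add, hx, hy, mul_add]
  | single g c =>
    rw [op_single_smul, map_smul, groupMap_single, SemigroupAlgebra.mul_smul]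
    congr 1
    induction m using SchutzenbergerModule.induction with
    | zero => rw [map_zero, map_zero, zero_mul]
    | add x y hx hy => rw [map_add, map_add, map_add, hx, hy, add_mul]
    | smul_of d x =>
      rw [map_smul, map_smul, map_smul, SemigroupAlgebra.smul_mul, rightTranslate_of,
        inclusion_of, inclusion_of, ← of_mul]
      rfl

variable {k e} [Ehresmann S] [Finite S] {M : Type w} [AddCommGroup M]
  [Module (SemigroupAlgebra k S) M]

/-- The inclusion `kL(e) → kS` does not in general respect left multiplication, because products
leaving `L(e)` are set to zero. At an apex such products annihilate `M`, so the discrepancy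
disappears after acting. -/
theorem inclusion_leftMul_smul (he : IsApex k e M) (s : S) (m : SchutzenbergerModule k e)
    (v : Corner k e M) :
    inclusion k e (leftMul k e s m) • (v : M) =
      SemigroupAlgebra.of k s • inclusion k e m • (v : M) := by
  induction m using SchutzenbergerModule.induction with
  | zero => rw [map_zero, map_zero, zero_smul, smul_zero]
  | add x y hx hy => rw [map_add, map_add, map_add, add_smul, hx, hy, add_smul, smul_add]
  | smul_of c x =>
    rw [map_smul, map_smul, map_smul, smul_smul, SemigroupAlgebra.mul_smul, smul_eq_one_mul,
      SemigroupAction.mul_smul, smul_eq_one_mul k c (_ * _), SemigroupAction.mul_smul]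
    congr 1
    rw [inclusion_of, ← of_mul]
    by_cases h : GreenL (s * x.1) e.1
    · rw [leftMul_of_pos k e h, inclusion_of]
    · rw [leftMul_of_neg k e h, map_zero, zero_smul,
        he.smul_eq_zero (by rw [mul_assoc, mul_idem]) h]

theorem inclusion_smul_smul (he : IsApex k e M) (a : SemigroupAlgebra k S)
    (m : SchutzenbergerModule k e) (v : Corner k e M) :
    inclusion k e (a • m) • (v : M) = a • inclusion k e m • (v : M) := by
  induction a using SemigroupAlgebra.induction with
  | zero => rw [zero_smul, map_zero, zero_smul, zero_smul]
  | add x y hx hy => rw [add_smul, map_add, add_smul, hx, hy, add_smul]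
  | smul_of c s =>
    rw [smul_def, map_smul, LinearMap.smul_apply, leftAction_of, map_smul, smul_eq_one_mul,
      smul_eq_one_mul k c (SemigroupAlgebra.of k s), SemigroupAction.mul_smul, SemigroupAction.mul_smul,
      inclusion_leftMul_smul he]

/-- The action map `Ind(eM) → M` at an apex `e`. -/
def InducedModule.counit (he : IsApex k e M) :
    InducedModule k e (Corner k e M) →ₗ[SemigroupAlgebra k S] M :=
  BimoduleTensor.lift
    (AddMonoidHom.mk' (fun m => AddMonoidHom.mk'
      (fun v : Corner k e M => inclusion k e m • (v : M))
      fun v v' => smul_add _ (v : M) v') fun m m' => AddMonoidHom.ext fun v => by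
        change inclusion k e (m + m') • (v : M) =
          inclusion k e m • (v : M) + inclusion k e m' • (v : M)
        rw [map_add, add_smul])
    (fun m r v => by
      change inclusion k e (MulOpposite.op r • m) • (v : M) =
        inclusion k e m • ((r • v : Corner k e M) : M)
      rw [inclusion_op_smul, SemigroupAction.mul_smul, Corner.coe_smul])
    fun a m v => inclusion_smul_smul he a m v

theorem InducedModule.counit_pure_base (he : IsApex k e M) (v : Corner k e M) :
    counit he (pure k (LClass.base e) v) = v := by
  change inclusion k e (SchutzenbergerModule.of k (LClass.base e)) • (v : M) = v
  rw [inclusion_of]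
  exact v.2

/-- A simple module with apex `e` is induced from `eM`. -/
theorem InducedModule.nonempty_equiv (hright : Ehresmann.IsRightRestriction S)
    (hEI : Ehresmann.IsEI S) [IsSimpleModule (SemigroupAlgebra k S) M] (he : IsApex k e M) :
    Nonempty (M ≃ₗ[SemigroupAlgebra k S] InducedModule k e (Corner k e M)) := by
  have := Corner.isSimpleModule he
  have := InducedModule.isSimpleModule k (e := e) (V := Corner k e M) hright hEI
  -- Schur's lemma: both modules are simple, and the map is nonzero because it sends `e ⊗ v` to `v`.
  refine ⟨(LinearEquiv.ofBijective (counit he) (LinearMap.bijective_of_ne_zero fun h => ?_)).symm⟩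
  have := Corner.nontrivial he
  obtain ⟨v, hv⟩ := exists_ne (0 : Corner k e M)
  apply hv
  apply Subtype.ext
  rw [← counit_pure_base he v, h]
  rfl

end Counit

/-! ### Recovering `V` from `Ind(V)`. -/

section Coord

variable {k : Type v} [Field k] {S : Type u} [Semigroup S] [Ehresmann S] [Finite S]
  {e : Idempotents S} {V V' : Type w} [AddCommGroup V] [AddCommGroup V']
  [Module (MonoidAlgebra k (MaxSubgroup e)) V] [Module (MonoidAlgebra k (MaxSubgroup e)) V']

namespace InducedModule

/-- The map `V → V'` induced by a morphism `Ind(V) → Ind(V')`. -/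
def restrict (φ : InducedModule k e V →ₗ[SemigroupAlgebra k S] InducedModule k e V') :
    V →ₗ[MonoidAlgebra k (MaxSubgroup e)] V' where
  toFun v := coord k e V' (φ (pure k (LClass.base e) v))
  map_add' v w := by rw [pure_add, map_add, map_add]
  map_smul' r v := by
    rw [← groupMap_smul_pure_base, map_smul, coord_smul, RingHom.id_apply]

/-- Replacing `t` by `e ⊗ coord t` is multiplication by `e`, which commutes with the isomorphism and
fixes `e ⊗ v`. -/
theorem restrict_restrict
    (φ : InducedModule k e V ≃ₗ[SemigroupAlgebra k S] InducedModule k e V') (v : V) :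
    restrict φ.symm.toLinearMap (restrict φ.toLinearMap v) = v := by
  change coord k e V (φ.symm (pure k (LClass.base e) (coord k e V'
    (φ (pure k (LClass.base e) v))))) = v
  rw [pure_base_coord, ← map_smul, of_idem_smul_pure_base, φ.symm_apply_apply, coord_pure_base]

/-- An isomorphism of induced modules restricts to an isomorphism. -/
def restrictEquiv (φ : InducedModule k e V ≃ₗ[SemigroupAlgebra k S] InducedModule k e V') :
    V ≃ₗ[MonoidAlgebra k (MaxSubgroup e)] V' :=
  LinearEquiv.ofLinearMap (restrict φ.toLinearMap) (restrict φ.symm.toLinearMap)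
    (LinearMap.ext fun v => restrict_restrict φ.symm v)
    (LinearMap.ext fun v => restrict_restrict φ v)

end InducedModule

end Coord

end

/-! ### The classification. -/

theorem mainTheorem2 (k : Type v) [Field k] (S : Type u) [Semigroup S] [Finite S] [Ehresmann S]
    (hright : Ehresmann.IsRightRestriction S) (hEI : Ehresmann.IsEI S)
    -- an arbitrary choice of an idempotent in every regular J-class
    (e : RegularJClass S → Idempotents S) (he : ∀ J, (e J).MemJClass J) :
    -- every induced module is simple
    (∀ (J : RegularJClass S) (V : Type w) [AddCommGroup V]
        [Module (MonoidAlgebra k (MaxSubgroup (e J))) V],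
        IsSimpleModule (MonoidAlgebra k (MaxSubgroup (e J))) V →
        IsSimpleModule (SemigroupAlgebra k S) (InducedModule k (e J) V)) ∧
    -- every simple module is isomorphic to an induced one
    (∀ (M : Type w) [AddCommGroup M] [Module (SemigroupAlgebra k S) M],
        IsSimpleModule (SemigroupAlgebra k S) M →
        ∃ (J : RegularJClass S) (V : Type w) (_ : AddCommGroup V)
          (_ : Module (MonoidAlgebra k (MaxSubgroup (e J))) V),
          IsSimpleModule (MonoidAlgebra k (MaxSubgroup (e J))) V ∧
          Nonempty (M ≃ₗ[SemigroupAlgebra k S] InducedModule k (e J) V)) ∧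
    -- the list has no repetitions: different J-classes
    (∀ (J J' : RegularJClass S) (V V' : Type w) [AddCommGroup V] [AddCommGroup V']
        [Module (MonoidAlgebra k (MaxSubgroup (e J))) V]
        [Module (MonoidAlgebra k (MaxSubgroup (e J'))) V'],
        IsSimpleModule (MonoidAlgebra k (MaxSubgroup (e J))) V →
        IsSimpleModule (MonoidAlgebra k (MaxSubgroup (e J'))) V' →
        Nonempty (InducedModule k (e J) V ≃ₗ[SemigroupAlgebra k S] InducedModule k (e J') V') →
        J = J') ∧
    -- the list has no repetitions: the same J-class
    (∀ (J : RegularJClass S) (V V' : Type w) [AddCommGroup V] [AddCommGroup V']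
        [Module (MonoidAlgebra k (MaxSubgroup (e J))) V]
        [Module (MonoidAlgebra k (MaxSubgroup (e J))) V'],
        IsSimpleModule (MonoidAlgebra k (MaxSubgroup (e J))) V →
        IsSimpleModule (MonoidAlgebra k (MaxSubgroup (e J))) V' →
        (Nonempty (InducedModule k (e J) V ≃ₗ[SemigroupAlgebra k S] InducedModule k (e J) V') ↔
          Nonempty (V ≃ₗ[MonoidAlgebra k (MaxSubgroup (e J))] V'))) := by
  refine ⟨fun J V _ _ _ => InducedModule.isSimpleModule k hright hEI, fun M _ _ _ => ?_,
    fun J J' V V' _ _ _ _ _ _ ⟨φ⟩ => ?_, fun J V V' _ _ _ _ _ _ =>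
      ⟨fun ⟨φ⟩ => ⟨InducedModule.restrictEquiv φ⟩, fun ⟨φ⟩ => ⟨BimoduleTensor.congr _ _ φ⟩⟩⟩
  · obtain ⟨p, hp⟩ := Ehresmann.exists_isApex (k := k) hEI M
    let J : RegularJClass S := ⟨Quotient.mk _ p.1, p.1, p.1, rfl, by rw [p.2.eq, p.2.eq]⟩
    -- The apex `p` found above need not be the chosen idempotent of its class, but being an apex
    -- depends only on the `J`-class.
    have hJ : IsApex k (e J) M := hp.of_greenJ (Quotient.exact (he J))
    exact ⟨J, Corner k (e J) M, inferInstance, inferInstance, Corner.isSimpleModule hJ,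
      InducedModule.nonempty_equiv hright hEI hJ⟩
  · have := IsSimpleModule.nontrivial (MonoidAlgebra k (MaxSubgroup (e J))) V
    have := IsSimpleModule.nontrivial (MonoidAlgebra k (MaxSubgroup (e J'))) V'
    -- Both chosen idempotents are apexes of the same module up to isomorphism.
    have h : GreenJ (e J).1 (e J').1 :=
      ((InducedModule.isApex k).congr φ).greenJ (InducedModule.isApex k)
    exact Subtype.ext ((he J).symm.trans ((Quotient.sound h).trans (he J')))
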